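/- Let $M$ be a compact connected smooth manifold of real dimension $2n$, $n\ge 2$. A Vaisman structure on $M$ is a triple $(J,g,\theta)$, where $J$ is a complex structure ($J^2=-\mathrm{Id}$ with vanishing Nijenhuis tensor), $g$ is a $J$-Hermitian Riemannian metric with fundamental form $\omega=g(J\cdot,\cdot)$, and $\theta$ is a closed non-exact real $1$-form with $d\omega=\theta\wedge\omega$, $\nabla^g\theta=0$ for the Levi-Civita connection $\nabla^g$, and $|\theta|_g=1$. Put $U=\theta^\#$, $V=JU$, $\theta^c=J\theta=-\theta\circ J$ and $\omega_0=-d\theta^c$. Let $T\Sigma=\mathrm{span}(U,V)$ be the tangent bundle of the characteristic foliation, $Q=TM/T\Sigma$, $N=T\Sigma^{\perp_g}$, and let $\bar J$ be the endomorphism of $Q$ induced by $J$. A real $1$-form $\zeta$ is basic if $\iota_X\zeta=0$ and $\mathcal L_X\zeta=0$ for every vector field $X$ tangent to $\Sigma$; denote the space of these forms by $\mathcal A^1_B(M,\mathbb R)$. **Proposition.** Let $(J,g,\theta)$ be a Vaisman structure on $M$. Let $$C=\{\zeta\in\mathcal A^1_B(M,\mathbb R) : \omega_0-d\zeta>0 \text{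 with respect to } J\},$$ where $\alpha>0$ with respect to $J$ means that the $2$-form $\alpha$ is of type $(1,1)$, i.e. $\alpha(JX,JY)=\alpha(X,Y)$, and $\alpha(X,JX)>0$ for all non-zero $X\in N$. Let $\mathcal V$ be the set of Vaisman structures $(J',g',\theta')$ on $M$ with $\theta'=\theta$, $U'=U$, $V'=V$ and $\bar J'=\bar J$ on $Q$. Then there is a bijection $C\to\mathcal V$, $\zeta\mapsto(J',g',\theta)$, under which $$J'=J-\zeta\otimes U-(\zeta\circ J)\otimes V,$$ and whose inverse sends $(J',g',\theta)$ to $\zeta=\theta'^c-\theta^c$, where $\theta'^c=J'\theta$. -/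

import Mathlib

open Bundle VectorField FiberBundle
open scoped Manifold ContDiff

namespace Vaisman

noncomputable section

variable {E : Type*} [NormedAddCommGroup E] [NormedSpace ℝ E]
  {M : Type*} [TopologicalSpace M] [ChartedSpace E M] [IsManifold 𝓘(ℝ, E) ∞ M]

/-! ### Smooth tensor fields on a manifold without boundary modelled on `E` -/

variable (E M) in
/-- Smooth real 1-forms: smooth sections of the cotangent bundle. -/
abbrev OneForm : Type _ :=
  ContMDiffSection 𝓘(ℝ, E) (E →L[ℝ] ℝ) ∞ (fun x : M ↦ TangentSpace 𝓘(ℝ, E) x →L[ℝ] ℝ)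

variable (E M) in
/-- Smooth sections of `End(TM)`. -/
abbrev EndField : Type _ :=
  ContMDiffSection 𝓘(ℝ, E) (E →L[ℝ] E) ∞
    (fun x : M ↦ TangentSpace 𝓘(ℝ, E) x →L[ℝ] TangentSpace 𝓘(ℝ, E) x)

variable (E M) in
/-- Smooth Riemannian metrics on `M`. -/
abbrev Metric : Type _ :=
  ContMDiffRiemannianMetric 𝓘(ℝ, E) ∞ E (fun x : M ↦ TangentSpace 𝓘(ℝ, E) x)

/-- A (not necessarily continuous) vector field is smooth. -/
def SmoothField (X : Π x : M, TangentSpace 𝓘(ℝ, E) x) : Prop :=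
  ContMDiff 𝓘(ℝ, E) 𝓘(ℝ, E).tangent ∞ (fun x ↦ (⟨x, X x⟩ : TangentBundle 𝓘(ℝ, E) M))

/-- The derivative `X f` of a function along a vector field. -/
def dirDeriv (X : Π x : M, TangentSpace 𝓘(ℝ, E) x) (f : M → ℝ) (x : M) : ℝ :=
  mvfderiv 𝓘(ℝ, E) f x (X x)

/-! ### Exterior derivatives -/

/-- `X(α(Y)) - Y(α(X)) - α([X, Y])`. -/
def extDerivAux (α : OneForm E M) (X Y : Π x : M, TangentSpace 𝓘(ℝ, E) x) (x : M) : ℝ :=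
  dirDeriv X (fun y ↦ α y (Y y)) x - dirDeriv Y (fun y ↦ α y (X y)) x
    - α x (mlieBracket 𝓘(ℝ, E) X Y x)

theorem mdiffAt_apply (α : OneForm E M) {X : Π x : M, TangentSpace 𝓘(ℝ, E) x} {x : M}
    (hX : MDiffAt (T% X) x) : MDiffAt (fun y ↦ α y (X y)) x := by
  have h1 : MDifferentiableAt 𝓘(ℝ, E) (𝓘(ℝ, E).prod 𝓘(ℝ, ℝ))
      (fun y ↦ TotalSpace.mk' ℝ (E := Bundle.Trivial M ℝ) y (α y (X y))) x :=
    MDifferentiableAt.clm_bundle_apply (F₁ := E) (F₂ := ℝ) (E₂ := Bundle.Trivial M ℝ)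
      (b := fun y : M ↦ y) (ϕ := fun y ↦ α y) (v := X) α.mdifferentiableAt hX
  exact (mdifferentiableAt_section (F := ℝ) (E := Bundle.Trivial M ℝ) 𝓘(ℝ, E)
    (fun y ↦ α y (X y))).1 h1

theorem extDerivAux_tensorial₁ [FiniteDimensional ℝ E] (α : OneForm E M) (x : M)
    (Y : Π x : M, TangentSpace 𝓘(ℝ, E) x) (_hY : MDiffAt (T% Y) x) :
    TensorialAt 𝓘(ℝ, E) E (fun X ↦ extDerivAux α X Y x) x where
  smul {f X} hf hX := by
    have : CompleteSpace E := FiniteDimensional.complete ℝ E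
    have : IsManifold 𝓘(ℝ, E) 2 M := .of_le (n := ∞) (by norm_cast)
    have h := mvfderiv_fun_mul hf (mdiffAt_apply α hX)
    simp [extDerivAux, dirDeriv, mlieBracket_smul_left hf hX, h]
    ring
  add {X X'} hX hX' := by
    have : CompleteSpace E := FiniteDimensional.complete ℝ E
    have : IsManifold 𝓘(ℝ, E) 2 M := .of_le (n := ∞) (by norm_cast)
    have h := mvfderiv_fun_add (mdiffAt_apply α hX) (mdiffAt_apply α hX')
    simp [extDerivAux, dirDeriv, mlieBracket_add_left hX hX', h]
    ring

theorem extDerivAux_swap (α : OneForm E M) (X Y : Π x : M, TangentSpace 𝓘(ℝ, E) x) (x : M) :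
    extDerivAux α X Y x = - extDerivAux α Y X x := by
  simp only [extDerivAux]
  rw [mlieBracket_swap]
  simp
  ring

theorem extDerivAux_tensorial₂ [FiniteDimensional ℝ E] (α : OneForm E M) (x : M)
    (X : Π x : M, TangentSpace 𝓘(ℝ, E) x) (hX : MDiffAt (T% X) x) :
    TensorialAt 𝓘(ℝ, E) E (fun Y ↦ extDerivAux α X Y x) x where
  smul {f Y} hf hY := by
    have := (extDerivAux_tensorial₁ α x X hX).smul hf hY
    simp only [extDerivAux_swap α X] at this ⊢
    rw [this, smul_neg]
  add {Y Y'} hY hY' := by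
    have := (extDerivAux_tensorial₁ α x X hX).add hY hY'
    simp only [extDerivAux_swap α X] at this ⊢
    rw [this, neg_add]

/-- A field of bilinear forms on the tangent spaces. -/
abbrev BilinField (E M : Type*) [NormedAddCommGroup E] [NormedSpace ℝ E] [TopologicalSpace M]
    [ChartedSpace E M] : Type _ :=
  Π x : M, TangentSpace 𝓘(ℝ, E) x →L[ℝ] TangentSpace 𝓘(ℝ, E) x →L[ℝ] ℝ

/-- The exterior derivative `dα` of a smooth 1-form, as a field of bilinear forms. -/
def extDeriv₁ [FiniteDimensional ℝ E] (α : OneForm E M) : BilinField E M := fun x ↦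
  haveI : IsManifold 𝓘(ℝ, E) 1 M := .of_le (n := ∞) (by exact_mod_cast le_top)
  TensorialAt.mkHom₂ (fun X Y ↦ extDerivAux α X Y x) x
    (extDerivAux_tensorial₁ α x) (extDerivAux_tensorial₂ α x)

/-- The formula `dα(X, Y) = X(α(Y)) - Y(α(X)) - α([X, Y])`, which characterises `dα`. -/
theorem extDeriv₁_apply [FiniteDimensional ℝ E] (α : OneForm E M) {x : M}
    {X Y : Π x : M, TangentSpace 𝓘(ℝ, E) x} (hX : MDiffAt (T% X) x) (hY : MDiffAt (T% Y) x) :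
    extDeriv₁ α x (X x) (Y x) =
      dirDeriv X (fun y ↦ α y (Y y)) x - dirDeriv Y (fun y ↦ α y (X y)) x
        - α x (mlieBracket 𝓘(ℝ, E) X Y x) :=
  haveI : IsManifold 𝓘(ℝ, E) 1 M := .of_le (n := ∞) (by exact_mod_cast le_top)
  TensorialAt.mkHom₂_apply (Φ := fun X Y ↦ extDerivAux α X Y x)
    (extDerivAux_tensorial₁ α x) (extDerivAux_tensorial₂ α x) hX hY

/-- The exterior derivative of a 2-form `Ω`, evaluated on three vector fields. -/
def extDeriv₂ (Ω : BilinField E M) (X Y Z : Π x : M, TangentSpace 𝓘(ℝ, E) x) (x : M) : ℝ :=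
  dirDeriv X (fun y ↦ Ω y (Y y) (Z y)) x
    - dirDeriv Y (fun y ↦ Ω y (X y) (Z y)) x
    + dirDeriv Z (fun y ↦ Ω y (X y) (Y y)) x
    - Ω x (mlieBracket 𝓘(ℝ, E) X Y x) (Z x)
    + Ω x (mlieBracket 𝓘(ℝ, E) X Z x) (Y x)
    - Ω x (mlieBracket 𝓘(ℝ, E) Y Z x) (X x)

/-- The wedge product `θ ∧ Ω` of a 1-form and a 2-form, evaluated on three vector fields. -/
def wedge₁₂ (θ : OneForm E M) (Ω : BilinField E M) (X Y Z : Π x : M, TangentSpace 𝓘(ℝ, E) x)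
    (x : M) : ℝ :=
  θ x (X x) * Ω x (Y x) (Z x) - θ x (Y x) * Ω x (X x) (Z x) + θ x (Z x) * Ω x (X x) (Y x)

/-- The Lie derivative `(L_X α)(Y) = X(α(Y)) - α([X, Y])` of a 1-form. -/
def lieDeriv₁ (X : Π x : M, TangentSpace 𝓘(ℝ, E) x) (α : OneForm E M)
    (Y : Π x : M, TangentSpace 𝓘(ℝ, E) x) (x : M) : ℝ :=
  dirDeriv X (fun y ↦ α y (Y y)) x - α x (mlieBracket 𝓘(ℝ, E) X Y x)

/-! ### Musical isomorphism and Levi-Civita connection -/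

theorem metric_bijective [FiniteDimensional ℝ E] (g : Metric E M) (x : M) :
    Function.Bijective (g.inner x) := by
  have : FiniteDimensional ℝ (TangentSpace 𝓘(ℝ, E) x) := inferInstanceAs (FiniteDimensional ℝ E)
  have : T2Space (TangentSpace 𝓘(ℝ, E) x) := inferInstanceAs (T2Space E)
  have hinj : Function.Injective (g.inner x) := by
    rw [injective_iff_map_eq_zero]
    intro v hv
    by_contra h
    have := g.pos x v h
    rw [hv] at this
    simp at this
  let e : Module.Dual ℝ (TangentSpace 𝓘(ℝ, E) x) ≃ₗ[ℝ] (TangentSpace 𝓘(ℝ, E) x →L[ℝ] ℝ) :=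
    LinearMap.toContinuousLinearMap
  have hdim : Module.finrank ℝ (TangentSpace 𝓘(ℝ, E) x) =
      Module.finrank ℝ (TangentSpace 𝓘(ℝ, E) x →L[ℝ] ℝ) := by
    rw [← e.finrank_eq, Subspace.dual_finrank_eq]
  have : FiniteDimensional ℝ (TangentSpace 𝓘(ℝ, E) x →L[ℝ] ℝ) := e.finiteDimensional
  exact ⟨hinj, (LinearMap.injective_iff_surjective_of_finrank_eq_finrank
    (f := (g.inner x).toLinearMap) hdim).1 hinj⟩

/-- The vector field `α^#` determined by `g(α^#, v) = α(v)`. -/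
def sharp [FiniteDimensional ℝ E] (g : Metric E M) (α : OneForm E M) (x : M) :
    TangentSpace 𝓘(ℝ, E) x :=
  (Equiv.ofBijective (g.inner x) (metric_bijective g x)).symm (α x)

theorem inner_sharp [FiniteDimensional ℝ E] (g : Metric E M) (α : OneForm E M) (x : M)
    (v : TangentSpace 𝓘(ℝ, E) x) : g.inner x (sharp g α x) v = α x v := by
  have := (Equiv.ofBijective (g.inner x) (metric_bijective g x)).apply_symm_apply (α x)
  exact DFunLike.congr_fun this v

variable (E M) in
/-- Affine connections on `M`. -/
abbrev AffineConnection : Type _ :=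
  CovariantDerivative 𝓘(ℝ, E) E (fun x : M ↦ TangentSpace 𝓘(ℝ, E) x)

/-- `D` is the Levi-Civita connection of `g`: it is torsion-free and `D g = 0`.
Here `D Y x v` is the derivative of `Y` in the direction `v` at the point `x`. -/
structure IsLeviCivita (g : Metric E M) (D : AffineConnection E M) : Prop where
  torsion_free : ∀ (X Y : Π x : M, TangentSpace 𝓘(ℝ, E) x) (x : M),
    MDiffAt (T% X) x → MDiffAt (T% Y) x →
      D Y x (X x) - D X x (Y x) = mlieBracket 𝓘(ℝ, E) X Y x
  metric : ∀ (X Y Z : Π x : M, TangentSpace 𝓘(ℝ, E) x) (x : M),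
    MDiffAt (T% Y) x → MDiffAt (T% Z) x →
      dirDeriv X (fun y ↦ g.inner y (Y y) (Z y)) x
        = g.inner x (D Y x (X x)) (Z x) + g.inner x (Y x) (D Z x (X x))

/-- `D α = 0`, where `(D_X α)(Y) = X(α(Y)) - α(D_X Y)`. -/
def IsParallel (D : AffineConnection E M) (α : OneForm E M) : Prop :=
  ∀ (X Y : Π x : M, TangentSpace 𝓘(ℝ, E) x) (x : M), MDiffAt (T% Y) x →
    dirDeriv X (fun y ↦ α y (Y y)) x - α x (D Y x (X x)) = 0

/-! ### Hermitian and Vaisman structures -/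

/-- `J` is a complex structure: `J² = -1` and the Nijenhuis tensor of `J` vanishes. -/
structure IsComplexStructure (J : EndField E M) : Prop where
  sq : ∀ (x : M) (v : TangentSpace 𝓘(ℝ, E) x), J x (J x v) = -v
  nijenhuis : ∀ X Y : Π x : M, TangentSpace 𝓘(ℝ, E) x, SmoothField X → SmoothField Y → ∀ x : M,
    mlieBracket 𝓘(ℝ, E) (fun y ↦ J y (X y)) (fun y ↦ J y (Y y)) x
      - J x (mlieBracket 𝓘(ℝ, E) (fun y ↦ J y (X y)) Y x)
      - J x (mlieBracket 𝓘(ℝ, E) X (fun y ↦ J y (Y y)) x)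
      - mlieBracket 𝓘(ℝ, E) X Y x = 0

/-- The 1-form `Jα = -α ∘ J`, at a point. -/
def actAux (J : EndField E M) (α : OneForm E M) (x : M) : TangentSpace 𝓘(ℝ, E) x →L[ℝ] ℝ :=
  -(α x ∘L J x)

theorem contMDiff_actAux (J : EndField E M) (α : OneForm E M) :
    ContMDiff 𝓘(ℝ, E) (𝓘(ℝ, E).prod 𝓘(ℝ, E →L[ℝ] ℝ)) ∞
      (fun x ↦ TotalSpace.mk' (E →L[ℝ] ℝ)
        (E := fun x : M ↦ TangentSpace 𝓘(ℝ, E) x →L[ℝ] ℝ) x (actAux J α x)) := by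
  intro x₀
  have hα := (contMDiffAt_hom_bundle (F₂ := ℝ) (E₂ := Bundle.Trivial M ℝ) (IB := 𝓘(ℝ, E))
    _).1 (α.contMDiff x₀)
  have hJ := (contMDiffAt_hom_bundle (IB := 𝓘(ℝ, E)) _).1 (J.contMDiff x₀)
  refine (contMDiffAt_hom_bundle (F₂ := ℝ) (E₂ := Bundle.Trivial M ℝ) (IB := 𝓘(ℝ, E)) _).2
    ⟨hα.1, (hα.2.clm_comp hJ.2).neg.congr_of_eventuallyEq ?_⟩
  have hb : ∀ᶠ x in nhds x₀,
      x ∈ (trivializationAt E (fun x : M ↦ TangentSpace 𝓘(ℝ, E) x) x₀).baseSet :=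
    (trivializationAt E (fun x : M ↦ TangentSpace 𝓘(ℝ, E) x) x₀).open_baseSet.mem_nhds
      (mem_baseSet_trivializationAt' x₀)
  have hb' : ∀ᶠ x in nhds x₀, x ∈ (trivializationAt ℝ (Bundle.Trivial M ℝ) x₀).baseSet :=
    (trivializationAt ℝ (Bundle.Trivial M ℝ) x₀).open_baseSet.mem_nhds
      (mem_baseSet_trivializationAt' x₀)
  filter_upwards [hb, hb'] with x hx hx'
  rw [ContinuousLinearMap.inCoordinates_eq hx hx', ContinuousLinearMap.inCoordinates_eq hx hx',
    ContinuousLinearMap.inCoordinates_eq hx hx]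
  ext v
  have h := (trivializationAt E (fun x : M ↦ TangentSpace 𝓘(ℝ, E) x) x₀).symm_apply_apply_mk hx
    (J x ((trivializationAt E (TangentSpace 𝓘(ℝ, E)) x₀).symm x v))
  simpa [actAux] using congrArg (α x) h.symm

/-- The smooth 1-form `Jα = -α ∘ J`. -/
def act (J : EndField E M) (α : OneForm E M) : OneForm E M :=
  ⟨actAux J α, contMDiff_actAux J α⟩

/-- The bilinear form `g(J ·, ·)`. -/
def fundamentalForm (J : EndField E M) (g : Metric E M) : BilinField E M :=
  fun x ↦ g.inner x ∘L J x

variable (E M) in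
/-- A Vaisman structure `(J, g, θ)` on `M`, with Lee form `θ` of length one. -/
@[ext]
structure VaismanStructure [FiniteDimensional ℝ E] where
  J : EndField E M
  g : Metric E M
  θ : OneForm E M
  complex : IsComplexStructure J
  hermitian : ∀ (x : M) (v w : TangentSpace 𝓘(ℝ, E) x),
    g.inner x (J x v) (J x w) = g.inner x v w
  /-- The Lee form is closed. -/
  closed : extDeriv₁ θ = 0
  /-- `dω = θ ∧ ω` for the fundamental form `ω`. -/
  lck : ∀ X Y Z : Π x : M, TangentSpace 𝓘(ℝ, E) x,
    SmoothField X → SmoothField Y → SmoothField Z → ∀ x : M,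
      extDeriv₂ (fundamentalForm J g) X Y Z x = wedge₁₂ θ (fundamentalForm J g) X Y Z x
  /-- The Lee form is parallel for the Levi-Civita connection of `g`. -/
  parallel : ∃ D : AffineConnection E M, IsLeviCivita g D ∧ IsParallel D θ
  /-- The Lee form has length one. -/
  unit : ∀ x : M, g.inner x (sharp g θ x) (sharp g θ x) = 1
  /-- The Lee form is not exact. -/
  not_exact : ¬ ∃ f : M → ℝ, ContMDiff 𝓘(ℝ, E) 𝓘(ℝ, ℝ) ∞ f ∧ ∀ x : M, θ x = mvfderiv 𝓘(ℝ, E) f x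

namespace VaismanStructure

variable [FiniteDimensional ℝ E] (S : VaismanStructure E M)

/-- `U = θ^#`. -/
def U (x : M) : TangentSpace 𝓘(ℝ, E) x := sharp S.g S.θ x

/-- `V = J U`. -/
def V (x : M) : TangentSpace 𝓘(ℝ, E) x := S.J x (S.U x)

/-- `θ^c = J θ = -θ ∘ J`. -/
def θc : OneForm E M := act S.J S.θ

/-- The transverse Kähler form `ω₀ = -dθ^c`. -/
def omega₀ : BilinField E M := -extDeriv₁ S.θc

/-- The tangent space at `x` of the characteristic foliation, spanned by `U` and `V`. -/
def leaf (x : M) : Submodule ℝ (TangentSpace 𝓘(ℝ, E) x) := Submodule.span ℝ {S.U x, S.V x}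

/-- The fibre at `x` of the normal bundle `N`, the orthogonal complement of the foliation. -/
def normal (x : M) : Set (TangentSpace 𝓘(ℝ, E) x) := {v | ∀ u ∈ S.leaf x, S.g.inner x u v = 0}

/-- Basic 1-forms: `ζ(X) = 0` and `L_X ζ = 0` for all smooth `X` tangent to the foliation. -/
def IsBasic (ζ : OneForm E M) : Prop :=
  ∀ X : Π x : M, TangentSpace 𝓘(ℝ, E) x, SmoothField X → (∀ x, X x ∈ S.leaf x) →
    (∀ x, ζ x (X x) = 0) ∧
    ∀ Y : Π x : M, TangentSpace 𝓘(ℝ, E) x, SmoothField Y → ∀ x, lieDeriv₁ X ζ Y x = 0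

/-- The 2-form `α` is of type `(1,1)` with respect to `J`, and positive definite on `N`:
`α(v, Jv) > 0` for all non-zero `v` in `N`. -/
structure IsPositive (α : BilinField E M) : Prop where
  type11 : ∀ (x : M) (v w : TangentSpace 𝓘(ℝ, E) x), α x (S.J x v) (S.J x w) = α x v w
  pos : ∀ (x : M), ∀ v ∈ S.normal x, v ≠ 0 → 0 < α x v (S.J x v)

/-- The basic 1-forms `ζ` such that `ω₀ - dζ` is positive with respect to `J`. -/
def positiveForms : Set (OneForm E M) :=
  {ζ | S.IsBasic ζ ∧ S.IsPositive (S.omega₀ - extDeriv₁ ζ)}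

/-- The Vaisman deformations of `S`: the Vaisman structures `(J', g', θ')` with `θ' = θ`, `U' = U`,
`V' = V`, and such that `J'` and `J` induce the same map on the quotient of `TM` by the tangent
bundle of the foliation. -/
def deformations : Set (VaismanStructure E M) :=
  {S' | S'.θ = S.θ ∧ S'.U = S.U ∧ S'.V = S.V ∧
    ∀ (x : M) (v : TangentSpace 𝓘(ℝ, E) x),
      (S.leaf x).mkQ (S'.J x v) = (S.leaf x).mkQ (S.J x v)}

end VaismanStructure

end

end Vaisman

set_option linter.unusedSectionVars false

namespace Vaisman

/-! ### Directional derivatives and Lie brackets -/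

section Calculus

open Filter Topology

variable {E : Type*} [NormedAddCommGroup E] [NormedSpace ℝ E]
  {M : Type*} [TopologicalSpace M] [ChartedSpace E M] [IsManifold 𝓘(ℝ, E) ∞ M]

/-! A Vaisman structure is determined by `J` and `θ`. Its Lee field `U` is Killing, because `θ` is
parallel, and holomorphic (`mlieBracket_U_J`), so `L_U ω = 0`. Since `ι_U ω = θ^c` and `dω = θ ∧ ω`,
Cartan's formula turns this into `ω = θ ∧ θ^c + ω₀` (`omega₀_apply`), that is, `g = ω₀(·, J·) + θ ⊗
θ + θ^c ⊗ θ^c` (`inner_eq`).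

From a deformation to a form: `J' - J` takes values in the leaves, where a vector is determined by
its values under `θ` and `θ^c`. These values are expressed by `ζ = θ'^c - θ^c`, which gives the
formula for `J'` (`J_eq_of_mem`). The form `ζ` is basic because `θ^c` and `θ'^c` agree on `U` and
`V` and both transverse forms annihilate the leaves. It is positive because `ω₀ - dζ = ω₀'`. The
formula for `g` then recovers `g'`.

From a form to a deformation: put `β = θ^c + ζ`, `α = ω₀ - dζ = -dβ`, define `J'` by the formula and
set `g' = α(·, J·) + θ ⊗ θ + β ⊗ β`. Then `β = -θ ∘ J'` and the fundamental form is `θ ∧ β - dβ`, so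
`dω' = θ ∧ ω'` follows from `dθ = 0` and `d² = 0`. The Nijenhuis tensor of `J'` is tangent to the
leaves, because `U` and `V` are `J`-holomorphic and commute (`nijenhuis_mem_leaf`), and it is killed
by `θ` and `β`, because `dθ = 0` and `dβ` is of type `(1,1)` (`apply_nijenhuis_eq_zero`). Hence it
vanishes. Finally `U` is the `g'`-dual of `θ`, and it preserves `θ`, `β`, `α` and `J`, hence `g'`.
For a closed form, a Killing dual field means that the form is parallel. -/

theorem isManifold_one : IsManifold 𝓘(ℝ, E) 1 M := .of_le (n := ∞) (by exact_mod_cast le_top)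

/-- The directional derivative, read in a chart. -/
theorem dirDeriv_extChartAt_symm {X : Π x : M, TangentSpace 𝓘(ℝ, E) x} {f : M → ℝ} (x : M) {z : E}
    (hz : z ∈ (extChartAt 𝓘(ℝ, E) x).target)
    (hf : MDifferentiableAt 𝓘(ℝ, E) 𝓘(ℝ, ℝ) f ((extChartAt 𝓘(ℝ, E) x).symm z)) :
    dirDeriv X f ((extChartAt 𝓘(ℝ, E) x).symm z) =
      fderiv ℝ (f ∘ (extChartAt 𝓘(ℝ, E) x).symm) z
        (mpullbackWithin 𝓘(ℝ, E) 𝓘(ℝ, E) (extChartAt 𝓘(ℝ, E) x).symm X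
          (Set.range 𝓘(ℝ, E)) z) := by
  have := isManifold_one (E := E) (M := M)
  have hinv := isInvertible_mfderivWithin_extChartAt_symm (I := 𝓘(ℝ, E)) hz
  have hd : MDifferentiableAt 𝓘(ℝ, E) 𝓘(ℝ, E) (extChartAt 𝓘(ℝ, E) x).symm z :=
    (contMDiffOn_extChartAt_symm (n := 1) x).contMDiffAt
      ((isOpen_extChartAt_target x).mem_nhds hz) |>.mdifferentiableAt one_ne_zero
  have h1 : mfderiv 𝓘(ℝ, E) 𝓘(ℝ, ℝ) (f ∘ (extChartAt 𝓘(ℝ, E) x).symm) z = _ :=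
    mfderiv_comp z hf hd
  rw [mfderiv_eq_fderiv] at h1
  rw [h1, mpullbackWithin_apply]
  simp only [ModelWithCorners.range_eq_univ, mfderivWithin_univ] at hinv ⊢
  obtain ⟨A, hA⟩ := hinv
  change _ = (mfderiv 𝓘(ℝ, E) 𝓘(ℝ, ℝ) f _) ((mfderiv 𝓘(ℝ, E) 𝓘(ℝ, E) _ z) _)
  rw [← hA, ContinuousLinearMap.inverse_equiv]
  erw [A.apply_symm_apply]
  rfl

/-- The directional derivative along `[X, Y]` is the commutator of the directional derivatives. -/
theorem dirDeriv_mlieBracket [CompleteSpace E] {X Y : Π x : M, TangentSpace 𝓘(ℝ, E) x} {f : M → ℝ}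
    {x : M} (hX : MDiffAt (T% X) x) (hY : MDiffAt (T% Y) x)
    (hf : ContMDiff 𝓘(ℝ, E) 𝓘(ℝ, ℝ) ∞ f)
    (hXf : MDifferentiableAt 𝓘(ℝ, E) 𝓘(ℝ, ℝ) (dirDeriv X f) x)
    (hYf : MDifferentiableAt 𝓘(ℝ, E) 𝓘(ℝ, ℝ) (dirDeriv Y f) x) :
    dirDeriv (mlieBracket 𝓘(ℝ, E) X Y) f x =
      dirDeriv X (dirDeriv Y f) x - dirDeriv Y (dirDeriv X f) x := by
  have := isManifold_one (E := E) (M := M)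
  have : IsManifold 𝓘(ℝ, E) 2 M := .of_le (n := ∞) (by norm_cast)
  set φ := extChartAt 𝓘(ℝ, E) x with hφ
  have hx : φ.symm (φ x) = x := extChartAt_to_inv x
  have hz : φ x ∈ φ.target := mem_extChartAt_target x
  have key : ∀ (X : Π x : M, TangentSpace 𝓘(ℝ, E) x) (h : M → ℝ),
      MDifferentiableAt 𝓘(ℝ, E) 𝓘(ℝ, ℝ) h x → dirDeriv X h x = fderiv ℝ (h ∘ φ.symm) (φ x)
        (mpullbackWithin 𝓘(ℝ, E) 𝓘(ℝ, E) φ.symm X (Set.range 𝓘(ℝ, E)) (φ x)) := by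
    intro X h hh
    have := dirDeriv_extChartAt_symm (X := X) (f := h) x hz (by rwa [← hφ, hx])
    rwa [← hφ, hx] at this
  have ev : ∀ (X : Π x : M, TangentSpace 𝓘(ℝ, E) x), dirDeriv X f ∘ φ.symm =ᶠ[𝓝 (φ x)]
      fun z ↦ fderiv ℝ (f ∘ φ.symm) z
        (mpullbackWithin 𝓘(ℝ, E) 𝓘(ℝ, E) φ.symm X (Set.range 𝓘(ℝ, E)) z) := by
    intro X
    filter_upwards [(isOpen_extChartAt_target (I := 𝓘(ℝ, E)) x).mem_nhds hz] with z hz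
    exact dirDeriv_extChartAt_symm x hz (hf.mdifferentiable (by simp) _)
  have hF : ContDiffAt ℝ 2 (f ∘ φ.symm) (φ x) := by
    rw [← contMDiffAt_iff_contDiffAt]
    refine ContMDiffAt.comp _ ((hf.of_le (by norm_cast)) _)
      ((contMDiffOn_extChartAt_symm (n := 2) x).contMDiffAt
        ((isOpen_extChartAt_target x).mem_nhds hz))
  have hdiff : ∀ X : Π x : M, TangentSpace 𝓘(ℝ, E) x, MDiffAt (T% X) x → DifferentiableAt ℝ
      (mpullbackWithin 𝓘(ℝ, E) 𝓘(ℝ, E) φ.symm X (Set.range 𝓘(ℝ, E))) (φ x) := by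
    intro X hX
    have := MDifferentiableWithinAt.differentiableWithinAt_mpullbackWithin_vectorField
      (hX.mdifferentiableWithinAt (s := Set.univ))
    rw [← hφ] at this
    simp only [Set.preimage_univ, Set.univ_inter, ModelWithCorners.range_eq_univ] at this ⊢
    exact differentiableWithinAt_univ.1 this
  rw [key X _ hYf, key Y _ hXf, (ev X).fderiv_eq, (ev Y).fderiv_eq, key _ _ (hf.mdifferentiable
    (by simp) _)]
  -- In the chart this is the symmetry of the second derivative of `f`. It remains to identify the
  -- pullback of the manifold bracket with the bracket of the pullbacks.
  erw [← fderiv_apply_lieBracket (n := 2) hF (by simp) (hdiff Y hY) (hdiff X hX)]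
  congr 1
  rw [mpullbackWithin_apply, hx, ← mlieBracketWithin_univ, mlieBracketWithin_apply, ← hφ]
  have h1 : mfderivWithin 𝓘(ℝ, E) 𝓘(ℝ, E) φ.symm (Set.range 𝓘(ℝ, E)) (φ x) =
      (mfderiv 𝓘(ℝ, E) 𝓘(ℝ, E) φ x).inverse :=
    (ContinuousLinearMap.inverse_eq
      (mfderiv_extChartAt_comp_mfderivWithin_extChartAt_symm' (mem_extChartAt_source x))
      (mfderivWithin_extChartAt_symm_comp_mfderiv_extChartAt' (mem_extChartAt_source x))).symm
  have h2 := isInvertible_mfderivWithin_extChartAt_symm (I := 𝓘(ℝ, E)) hz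
  rw [← hφ] at h2
  rw [← h1]
  refine (h2.inverse_apply_self _).trans ?_
  simp only [Set.preimage_univ, Set.univ_inter, ModelWithCorners.range_eq_univ]
  exact congrFun (lieBracketWithin_univ (𝕜 := ℝ) (E := E)) (φ x)

end Calculus

/-! ### Smooth functions and vector fields -/

section Smoothness

open Filter Topology

variable {E : Type*} [NormedAddCommGroup E] [NormedSpace ℝ E]
  {M : Type*} [TopologicalSpace M] [ChartedSpace E M] [IsManifold 𝓘(ℝ, E) ∞ M]

/-- Smooth real functions. -/
abbrev SmoothFun (f : M → ℝ) : Prop := ContMDiff 𝓘(ℝ, E) 𝓘(ℝ, ℝ) ∞ f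

variable {X Y Z : Π x : M, TangentSpace 𝓘(ℝ, E) x} {f h : M → ℝ}

theorem SmoothField.mdiffAt (hX : SmoothField X) (x : M) : MDiffAt (T% X) x :=
  hX.mdifferentiable (by simp) x

theorem SmoothFun.mdiffAt (hf : SmoothFun (E := E) f) (x : M) :
    MDifferentiableAt 𝓘(ℝ, E) 𝓘(ℝ, ℝ) f x :=
  hf.mdifferentiable (by simp) x

theorem SmoothFun.fun_add (hf : SmoothFun (E := E) f) (hh : SmoothFun (E := E) h) :
    SmoothFun (E := E) (fun x ↦ f x + h x) :=
  ContMDiff.add hf hh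

theorem SmoothFun.fun_sub (hf : SmoothFun (E := E) f) (hh : SmoothFun (E := E) h) :
    SmoothFun (E := E) (fun x ↦ f x - h x) :=
  ContMDiff.sub hf hh

theorem SmoothFun.fun_mul (hf : SmoothFun (E := E) f) (hh : SmoothFun (E := E) h) :
    SmoothFun (E := E) (fun x ↦ f x * h x) :=
  ContMDiff.mul hf hh

theorem SmoothField.add (hX : SmoothField X) (hY : SmoothField Y) :
    SmoothField (fun x ↦ X x + Y x) :=
  ContMDiff.add_section hX hY

theorem SmoothField.sub (hX : SmoothField X) (hY : SmoothField Y) :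
    SmoothField (fun x ↦ X x - Y x) :=
  ContMDiff.sub_section hX hY

theorem SmoothField.smul (hf : SmoothFun (E := E) f) (hX : SmoothField X) :
    SmoothField (fun x ↦ f x • X x) :=
  ContMDiff.smul_section hf hX

theorem SmoothField.endField (J : EndField E M) (hX : SmoothField X) :
    SmoothField (fun x ↦ J x (X x)) :=
  ContMDiff.clm_bundle_apply J.contMDiff hX

theorem SmoothField.mlieBracket [CompleteSpace E] (hX : SmoothField X) (hY : SmoothField Y) :
    SmoothField (mlieBracket 𝓘(ℝ, E) X Y) := by
  -- Here `∞ + 1 = ∞`, so the derivative lost in the bracket costs nothing.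
  have : IsManifold 𝓘(ℝ, E) ((⊤ : ℕ∞) + 1) M := ‹IsManifold 𝓘(ℝ, E) ∞ M›
  have : IsManifold 𝓘(ℝ, E) (minSmoothness ℝ 2) M := by simpa using! (.of_le (n := ∞) (by norm_cast))
  exact ContDiff.mlieBracket_vectorField (m := ⊤) (n := ⊤) hX hY (by simp)

theorem smoothFun_iff : SmoothFun (E := E) f ↔ ContMDiff 𝓘(ℝ, E) (𝓘(ℝ, E).prod 𝓘(ℝ, ℝ)) ∞
    (fun y ↦ TotalSpace.mk' ℝ (E := Bundle.Trivial M ℝ) y (f y)) := by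
  exact forall_congr' fun x ↦ (contMDiffAt_section (F := ℝ) (E := Bundle.Trivial M ℝ) x).symm

theorem OneForm.smoothFun (α : OneForm E M) (hX : SmoothField X) :
    SmoothFun (E := E) (fun x ↦ α x (X x)) :=
  smoothFun_iff.2 <| ContMDiff.clm_bundle_apply (F₁ := E) (F₂ := ℝ) (E₂ := Bundle.Trivial M ℝ)
      (b := fun y : M ↦ y) (ϕ := fun y ↦ α y) (v := X) α.contMDiff hX

/-- `X f` is the fibre component of the tangent map of `f` composed with the section `X`. -/
theorem smoothFun_dirDeriv (hX : SmoothField X) (hf : SmoothFun (E := E) f) :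
    SmoothFun (E := E) (dirDeriv X f) := by
  have : IsManifold 𝓘(ℝ, E) 1 M := isManifold_one
  have h1 : ContMDiff 𝓘(ℝ, E).tangent 𝓘(ℝ, ℝ).tangent ∞ (tangentMap 𝓘(ℝ, E) 𝓘(ℝ, ℝ) f) :=
    hf.contMDiff_tangentMap (by simp)
  exact (contMDiff_snd_tangentBundle_modelSpace ℝ 𝓘(ℝ, ℝ)).comp (h1.comp hX)

theorem dirDeriv_add (hf : SmoothFun (E := E) f) (hh : SmoothFun (E := E) h) (x : M) :
    dirDeriv X (fun y ↦ f y + h y) x = dirDeriv X f x + dirDeriv X h x := by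
  simp [dirDeriv, mvfderiv_fun_add (hf.mdiffAt x) (hh.mdiffAt x)]

theorem dirDeriv_sub (hf : SmoothFun (E := E) f) (hh : SmoothFun (E := E) h) (x : M) :
    dirDeriv X (fun y ↦ f y - h y) x = dirDeriv X f x - dirDeriv X h x := by
  simp [dirDeriv, mvfderiv_fun_sub (hf.mdiffAt x) (hh.mdiffAt x)]

theorem dirDeriv_neg (x : M) :
    dirDeriv X (fun y ↦ - f y) x = - dirDeriv X f x := by
  simp [dirDeriv, mvfderiv_fun_neg]

theorem dirDeriv_mul (hf : SmoothFun (E := E) f) (hh : SmoothFun (E := E) h) (x : M) :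
    dirDeriv X (fun y ↦ f y * h y) x =
      f x * dirDeriv X h x + h x * dirDeriv X f x := by
  simp [dirDeriv, mvfderiv_fun_mul (hf.mdiffAt x) (hh.mdiffAt x)]

theorem dirDeriv_const (c : ℝ) (x : M) :
    dirDeriv X (fun _ ↦ c) x = 0 := by
  simp [dirDeriv, mvfderiv_const]

end Smoothness

/-! ### Extension of tangent vectors to smooth fields -/

section Extension

open Filter Topology

variable {E : Type*} [NormedAddCommGroup E] [NormedSpace ℝ E] [FiniteDimensional ℝ E]
  {M : Type*} [TopologicalSpace M] [ChartedSpace E M] [IsManifold 𝓘(ℝ, E) ∞ M] [T2Space M]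

/-- A local frame field extends to a smooth vector field on the manifold. -/
theorem exists_smoothField_eventuallyEq (x : M) (v : E) :
    ∃ X : Π x : M, TangentSpace 𝓘(ℝ, E) x, SmoothField X ∧
      ∀ᶠ y in 𝓝 x, X y = (trivializationAt E (TangentSpace 𝓘(ℝ, E)) x).symmL ℝ y v := by
  obtain ⟨ψ⟩ : Nonempty (SmoothBumpFunction 𝓘(ℝ, E) x) := inferInstance
  set t := trivializationAt E (TangentSpace 𝓘(ℝ, E)) x
  refine ⟨(ψ : M → ℝ) • fun y ↦ t.symmL ℝ y v, ?_, ?_⟩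
  · refine ContMDiffOn.smul_section_of_tsupport (u := t.baseSet) ψ.contMDiff.contMDiffOn
      t.open_baseSet ?_ ?_
    · exact ψ.tsupport_subset_chartAt_source
    · have h := t.contMDiffOn_symmL (n := ∞) (IB := 𝓘(ℝ, E))
      have := ContMDiffOn.clm_bundle_apply (F₁ := E) (F₂ := E) (E₁ := Bundle.Trivial M E)
        (E₂ := TangentSpace 𝓘(ℝ, E)) (b := fun y : M ↦ y) (v := fun _ ↦ v) h
        (fun y _ ↦ contMDiffWithinAt_section.2 contMDiffWithinAt_const)
      exact this
  · filter_upwards [ψ.eventuallyEq_one] with y hy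
    simp [hy, t]

/-- Reduces a tensor identity at a point to an identity for globally smooth vector fields, where the
bracket formulas apply. -/
theorem exists_smoothField (x : M) (v : TangentSpace 𝓘(ℝ, E) x) :
    ∃ X : Π x : M, TangentSpace 𝓘(ℝ, E) x, SmoothField X ∧ X x = v := by
  obtain ⟨X, hX, h⟩ := exists_smoothField_eventuallyEq x
    ((trivializationAt E (TangentSpace 𝓘(ℝ, E)) x).continuousLinearMapAt ℝ x v)
  refine ⟨X, hX, h.self_of_nhds.trans ?_⟩
  exact Trivialization.symmL_continuousLinearMapAt (R := ℝ)
    (trivializationAt E (TangentSpace 𝓘(ℝ, E)) x) (mem_baseSet_trivializationAt' x) v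

end Extension

/-! ### Smoothness of tensor fields tested on vector fields -/

section SmoothTensor

open Filter Topology

variable {E : Type*} [NormedAddCommGroup E] [NormedSpace ℝ E] [FiniteDimensional ℝ E]

/-- A map into a space of linear maps on a finite-dimensional space is smooth if all its
evaluations are. -/
theorem contMDiffAt_clm_of_apply {F : Type*} [NormedAddCommGroup F] [NormedSpace ℝ F]
    {M : Type*} [TopologicalSpace M] [ChartedSpace E M] {φ : M → E →L[ℝ] F} {x : M}
    (h : ∀ v, ContMDiffAt 𝓘(ℝ, E) 𝓘(ℝ, F) ∞ (fun y ↦ φ y v) x) :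
    ContMDiffAt 𝓘(ℝ, E) 𝓘(ℝ, E →L[ℝ] F) ∞ φ x := by
  let b := Module.finBasis ℝ E
  -- A linear map is the finite sum of the `bᵢ* ⊗ φ(bᵢ)`, so smoothness of the values on a basis is
  -- enough.
  have hφ : φ = fun y ↦ ∑ i, (ContinuousLinearMap.smulRightL ℝ E F
      (LinearMap.toContinuousLinearMap (b.coord i))) (φ y (b i)) := by
    ext y v
    conv_lhs => rw [← b.sum_repr v]
    simp [-Module.Basis.sum_repr]
  rw [hφ]
  exact contMDiffAt_finsetSum fun i _ ↦
    (ContinuousLinearMap.contMDiffAt _).comp x (h (b i))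

variable {M : Type*} [TopologicalSpace M] [ChartedSpace E M] [IsManifold 𝓘(ℝ, E) ∞ M]

/-- The sharp of a smooth 1-form is a smooth vector field. -/
theorem smoothField_sharp (g : Metric E M) (α : OneForm E M) : SmoothField (sharp g α) := by
  intro x
  have hG := ((contMDiffAt_hom_bundle (F₂ := E →L[ℝ] ℝ)
    (E₂ := fun x : M ↦ TangentSpace 𝓘(ℝ, E) x →L[ℝ] ℝ) (IB := 𝓘(ℝ, E)) _).1 (g.contMDiff x)).2
  have hα := (contMDiffAt_section x).1 (α.contMDiff x)
  refine (contMDiffAt_section (F := E) (E := TangentSpace 𝓘(ℝ, E)) x).2 ?_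
  set t := trivializationAt E (TangentSpace 𝓘(ℝ, E)) x
  set t' := trivializationAt (E →L[ℝ] ℝ) (fun x : M ↦ TangentSpace 𝓘(ℝ, E) x →L[ℝ] ℝ) x
  set G : M → E →L[ℝ] E →L[ℝ] ℝ := fun y ↦ ContinuousLinearMap.inCoordinates E
    (TangentSpace 𝓘(ℝ, E)) (E →L[ℝ] ℝ) (fun x : M ↦ TangentSpace 𝓘(ℝ, E) x →L[ℝ] ℝ) x y x y
    (g.inner y)
  have hbase : ∀ᶠ y in 𝓝 x, y ∈ t.baseSet ∧ y ∈ t'.baseSet :=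
    Filter.Eventually.and (t.open_baseSet.mem_nhds (mem_baseSet_trivializationAt' x))
      (t'.open_baseSet.mem_nhds (mem_baseSet_trivializationAt' x))
  have hGeq : ∀ y, y ∈ t.baseSet ∧ y ∈ t'.baseSet → ∀ v : TangentSpace 𝓘(ℝ, E) y,
      G y (t ⟨y, v⟩).2 = (t' ⟨y, g.inner y v⟩).2 := by
    intro y hy v
    simp only [G, ContinuousLinearMap.inCoordinates_eq hy.1 hy.2]
    change t'.continuousLinearEquivAt ℝ y hy.2 (g.inner y ((t.continuousLinearEquivAt ℝ y hy.1).symm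
      (t.continuousLinearEquivAt ℝ y hy.1 v))) = _
    rw [ContinuousLinearEquiv.symm_apply_apply]
    rfl
  have hGinv : ∀ y, y ∈ t.baseSet ∧ y ∈ t'.baseSet → (G y).IsInvertible := by
    intro y hy
    have hinj : Function.Injective (G y) := by
      simp only [G, ContinuousLinearMap.inCoordinates_eq hy.1 hy.2]
      exact (t'.continuousLinearEquivAt ℝ y hy.2).injective.comp
        ((metric_bijective g y).1.comp (t.continuousLinearEquivAt ℝ y hy.1).symm.injective)
    have hdim : Module.finrank ℝ E = Module.finrank ℝ (E →L[ℝ] ℝ) := by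
      rw [← (LinearMap.toContinuousLinearMap (𝕜 := ℝ) (E := E) (F' := ℝ)).finrank_eq]
      exact (Subspace.dual_finrank_eq (K := ℝ) (V := E)).symm
    exact ⟨(LinearEquiv.ofInjectiveOfFinrankEq (G y).toLinearMap hinj hdim
      ).toContinuousLinearEquiv, by ext v; rfl⟩
  -- `G` is the metric in the trivializations, a family of isomorphisms `E → E*`. Inversion is
  -- smooth at an isomorphism, and the sharp is `G⁻¹` applied to the coordinates of `α`.
  have hinv : ContMDiffAt 𝓘(ℝ, E) 𝓘(ℝ, (E →L[ℝ] ℝ) →L[ℝ] E) ∞ (fun y ↦ (G y).inverse) x := by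
    have : CompleteSpace E := FiniteDimensional.complete ℝ E
    obtain ⟨e, he⟩ := hGinv x hbase.self_of_nhds
    have := (contDiffAt_map_inverse (n := ∞) e).contMDiffAt
    rw [he] at this
    exact this.comp x hG
  refine (hinv.clm_apply hα).congr_of_eventuallyEq ?_
  filter_upwards [hbase] with y hy
  have : g.inner y (sharp g α y) = α y := by ext v; exact inner_sharp g α y v
  rw [← this, ← hGeq y hy, (hGinv y hy).inverse_apply_self]

variable [T2Space M]

/-- A field of linear maps from the tangent bundle to a vector bundle is smooth if it maps smooth
vector fields to smooth sections. -/
theorem contMDiff_clm_of_apply {F : Type*} [NormedAddCommGroup F] [NormedSpace ℝ F]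
    {V : M → Type*} [TopologicalSpace (TotalSpace F V)] [∀ x, AddCommGroup (V x)]
    [∀ x, Module ℝ (V x)] [∀ x, TopologicalSpace (V x)] [FiberBundle F V] [VectorBundle ℝ F V]
    [∀ x, IsTopologicalAddGroup (V x)] [∀ x, ContinuousSMul ℝ (V x)]
    (φ : Π x : M, TangentSpace 𝓘(ℝ, E) x →L[ℝ] V x)
    (h : ∀ X : Π x : M, TangentSpace 𝓘(ℝ, E) x, SmoothField X →
      ContMDiff 𝓘(ℝ, E) (𝓘(ℝ, E).prod 𝓘(ℝ, F)) ∞ (fun x ↦ TotalSpace.mk' F x (φ x (X x)))) :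
    ContMDiff 𝓘(ℝ, E) (𝓘(ℝ, E).prod 𝓘(ℝ, E →L[ℝ] F)) ∞
      (fun x ↦ TotalSpace.mk' (E →L[ℝ] F) (E := fun x : M ↦ TangentSpace 𝓘(ℝ, E) x →L[ℝ] V x)
        x (φ x)) := by
  intro x
  refine (contMDiffAt_hom_bundle _).2 ⟨contMDiffAt_id, contMDiffAt_clm_of_apply fun v ↦ ?_⟩
  obtain ⟨X, hX, hXv⟩ := exists_smoothField_eventuallyEq x v
  refine ((contMDiffAt_section x).1 (h X hX x)).congr_of_eventuallyEq ?_
  filter_upwards [hXv, (trivializationAt F V x).open_baseSet.mem_nhds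
    (mem_baseSet_trivializationAt' x), (trivializationAt E (TangentSpace 𝓘(ℝ, E)) x
    ).open_baseSet.mem_nhds (mem_baseSet_trivializationAt' x)] with y hy hy1 hy2
  simp [hy, ContinuousLinearMap.inCoordinates_eq hy2 hy1, Trivialization.symmL_apply _ hy2]

theorem contMDiff_oneForm_of_apply (φ : Π x : M, TangentSpace 𝓘(ℝ, E) x →L[ℝ] ℝ)
    (h : ∀ X : Π x : M, TangentSpace 𝓘(ℝ, E) x, SmoothField X →
      SmoothFun (E := E) (fun x ↦ φ x (X x))) :
    ContMDiff 𝓘(ℝ, E) (𝓘(ℝ, E).prod 𝓘(ℝ, E →L[ℝ] ℝ)) ∞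
      (fun x ↦ TotalSpace.mk' (E →L[ℝ] ℝ) (E := fun x : M ↦ TangentSpace 𝓘(ℝ, E) x →L[ℝ] ℝ)
        x (φ x)) :=
  contMDiff_clm_of_apply (V := Bundle.Trivial M ℝ) φ fun X hX ↦ smoothFun_iff.1 (h X hX)

theorem contMDiff_bilin_of_apply (B : BilinField E M)
    (h : ∀ X Y : Π x : M, TangentSpace 𝓘(ℝ, E) x, SmoothField X → SmoothField Y →
      SmoothFun (E := E) (fun x ↦ B x (X x) (Y x))) :
    ContMDiff 𝓘(ℝ, E) (𝓘(ℝ, E).prod 𝓘(ℝ, E →L[ℝ] E →L[ℝ] ℝ)) ∞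
      (fun x ↦ TotalSpace.mk' (E →L[ℝ] E →L[ℝ] ℝ)
        (E := fun x : M ↦ TangentSpace 𝓘(ℝ, E) x →L[ℝ] TangentSpace 𝓘(ℝ, E) x →L[ℝ] ℝ)
        x (B x)) :=
  contMDiff_clm_of_apply (V := fun x : M ↦ TangentSpace 𝓘(ℝ, E) x →L[ℝ] ℝ) B
    fun X hX ↦ contMDiff_oneForm_of_apply _ fun Y hY ↦ h X Y hX hY

end SmoothTensor

/-! ### Exterior derivative of 1-forms and `d² = 0` -/

section ExteriorDerivative

variable {E : Type*} [NormedAddCommGroup E] [NormedSpace ℝ E] [FiniteDimensional ℝ E]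
  {M : Type*} [TopologicalSpace M] [ChartedSpace E M] [IsManifold 𝓘(ℝ, E) ∞ M]
  {X Y Z : Π x : M, TangentSpace 𝓘(ℝ, E) x}

theorem extDeriv₁_fields (α : OneForm E M) (hX : SmoothField X) (hY : SmoothField Y) (x : M) :
    extDeriv₁ α x (X x) (Y x) =
      dirDeriv X (fun y ↦ α y (Y y)) x - dirDeriv Y (fun y ↦ α y (X y)) x
        - α x (mlieBracket 𝓘(ℝ, E) X Y x) :=
  extDeriv₁_apply α (hX.mdiffAt x) (hY.mdiffAt x)

theorem smoothFun_extDeriv₁ (α : OneForm E M) (hX : SmoothField X) (hY : SmoothField Y) :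
    SmoothFun (E := E) (fun x ↦ extDeriv₁ α x (X x) (Y x)) := by
  have : CompleteSpace E := FiniteDimensional.complete ℝ E
  simp only [extDeriv₁_fields α hX hY]
  exact ((smoothFun_dirDeriv hX (α.smoothFun hY)).sub (smoothFun_dirDeriv hY (α.smoothFun hX))).sub
    (α.smoothFun (hX.mlieBracket hY))

/-- The exterior derivative squares to zero on 1-forms. -/
theorem extDeriv₂_extDeriv₁ (α : OneForm E M) (hX : SmoothField X) (hY : SmoothField Y)
    (hZ : SmoothField Z) (x : M) : extDeriv₂ (extDeriv₁ α) X Y Z x = 0 := by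
  have : CompleteSpace E := FiniteDimensional.complete ℝ E
  have : IsManifold 𝓘(ℝ, E) (minSmoothness ℝ 3) M := by simpa using! (.of_le (n := ∞) (by norm_cast))
  have main : ∀ {X Y Z : Π x : M, TangentSpace 𝓘(ℝ, E) x}, SmoothField X → SmoothField Y →
      SmoothField Z → dirDeriv X (fun y ↦ extDeriv₁ α y (Y y) (Z y)) x =
        dirDeriv X (dirDeriv Y (fun y ↦ α y (Z y))) x - dirDeriv X (dirDeriv Z (fun y ↦ α y (Y y))) x
          - dirDeriv X (fun y ↦ α y (mlieBracket 𝓘(ℝ, E) Y Z y)) x := by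
    intro X Y Z hX hY hZ
    simp only [extDeriv₁_fields α hY hZ]
    have h1 := smoothFun_dirDeriv hY (α.smoothFun hZ)
    have h2 := smoothFun_dirDeriv hZ (α.smoothFun hY)
    rw [dirDeriv_sub (h1.sub h2) (α.smoothFun (hY.mlieBracket hZ)), dirDeriv_sub h1 h2]
  have comm : ∀ {X Y Z : Π x : M, TangentSpace 𝓘(ℝ, E) x}, SmoothField X → SmoothField Y →
      SmoothField Z → dirDeriv (mlieBracket 𝓘(ℝ, E) X Y) (fun y ↦ α y (Z y)) x =
        dirDeriv X (dirDeriv Y (fun y ↦ α y (Z y))) x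
          - dirDeriv Y (dirDeriv X (fun y ↦ α y (Z y))) x := by
    intro X Y Z hX hY hZ
    have h := α.smoothFun hZ
    exact dirDeriv_mlieBracket (hX.mdiffAt x) (hY.mdiffAt x) h
      ((smoothFun_dirDeriv hX h).mdiffAt x) ((smoothFun_dirDeriv hY h).mdiffAt x)
  have h2 : minSmoothness ℝ 2 ≤ ((⊤ : ℕ∞) : WithTop ℕ∞) := by simpa using! (by norm_cast)
  -- Second derivatives cancel by `comm`, and the derivatives of `α` on brackets cancel in pairs.
  -- What is left is `α` applied to the Jacobi sum.
  have jac := leibniz_identity_mlieBracket_apply (I := 𝓘(ℝ, E)) (U := X) (V := Y) (W := Z) (x := x)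
    ((hX x).of_le h2) ((hY x).of_le h2) ((hZ x).of_le h2)
  rw [mlieBracket_swap_apply (V := X) (W := mlieBracket 𝓘(ℝ, E) Y Z),
    mlieBracket_swap_apply (V := Y) (W := mlieBracket 𝓘(ℝ, E) X Z)] at jac
  have jac' := congrArg (α x) jac
  simp only [map_neg, map_add] at jac'
  simp only [extDeriv₂, main hX hY hZ, main hY hX hZ, main hZ hX hY,
    extDeriv₁_fields α (hX.mlieBracket hY) hZ, extDeriv₁_fields α (hX.mlieBracket hZ) hY,
    extDeriv₁_fields α (hY.mlieBracket hZ) hX, comm hX hY hZ, comm hX hZ hY, comm hY hZ hX]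
  linarith

variable [T2Space M]

theorem extDeriv₁_swap (α : OneForm E M) (x : M) (v w : TangentSpace 𝓘(ℝ, E) x) :
    extDeriv₁ α x v w = - extDeriv₁ α x w v := by
  obtain ⟨X, hX, rfl⟩ := exists_smoothField x v
  obtain ⟨Y, hY, rfl⟩ := exists_smoothField x w
  rw [extDeriv₁_fields α hX hY, extDeriv₁_fields α hY hX, mlieBracket_swap_apply, map_neg]
  ring

theorem extDeriv₁_add (α β : OneForm E M) (x : M) (v w : TangentSpace 𝓘(ℝ, E) x) :
    extDeriv₁ (α + β) x v w = extDeriv₁ α x v w + extDeriv₁ β x v w := by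
  obtain ⟨X, hX, rfl⟩ := exists_smoothField x v
  obtain ⟨Y, hY, rfl⟩ := exists_smoothField x w
  simp only [extDeriv₁_fields _ hX hY, ContMDiffSection.coe_add, Pi.add_apply,
    add_apply]
  rw [dirDeriv_add (α.smoothFun hY) (β.smoothFun hY), dirDeriv_add (α.smoothFun hX) (β.smoothFun hX)]
  ring

/-- The exterior derivative of `θ ∧ β - dβ` for a closed 1-form `θ`. -/
theorem extDeriv₂_wedge_sub {θ β : OneForm E M} (hθ : extDeriv₁ θ = 0) {Ω : BilinField E M}
    (hΩ : ∀ (x : M) (v w : TangentSpace 𝓘(ℝ, E) x),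
      Ω x v w = θ x v * β x w - θ x w * β x v - extDeriv₁ β x v w)
    (hX : SmoothField X) (hY : SmoothField Y) (hZ : SmoothField Z) (x : M) :
    extDeriv₂ Ω X Y Z x = wedge₁₂ θ Ω X Y Z x := by
  have : CompleteSpace E := FiniteDimensional.complete ℝ E
  have main : ∀ {X Y Z : Π x : M, TangentSpace 𝓘(ℝ, E) x}, SmoothField X → SmoothField Y →
      SmoothField Z → dirDeriv X (fun y ↦ Ω y (Y y) (Z y)) x =
        θ x (Y x) * dirDeriv X (fun y ↦ β y (Z y)) x + β x (Z x) * dirDeriv X (fun y ↦ θ y (Y y)) x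
        - (θ x (Z x) * dirDeriv X (fun y ↦ β y (Y y)) x
          + β x (Y x) * dirDeriv X (fun y ↦ θ y (Z y)) x)
        - dirDeriv X (fun y ↦ extDeriv₁ β y (Y y) (Z y)) x := by
    intro X Y Z hX hY hZ
    simp only [hΩ]
    have h1 := θ.smoothFun hY
    have h2 := θ.smoothFun hZ
    have h3 := β.smoothFun hY
    have h4 := β.smoothFun hZ
    have h5 := SmoothFun.fun_mul h1 h4
    have h6 := SmoothFun.fun_mul h2 h3
    rw [dirDeriv_sub (SmoothFun.fun_sub h5 h6) (smoothFun_extDeriv₁ β hY hZ), dirDeriv_sub h5 h6, dirDeriv_mul h1 h4, dirDeriv_mul h2 h3]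
  have dd := extDeriv₂_extDeriv₁ β hX hY hZ x
  have θ0 : ∀ {X Y : Π x : M, TangentSpace 𝓘(ℝ, E) x}, SmoothField X → SmoothField Y →
      dirDeriv X (fun y ↦ θ y (Y y)) x =
        dirDeriv Y (fun y ↦ θ y (X y)) x + θ x (mlieBracket 𝓘(ℝ, E) X Y x) := by
    intro X Y hX hY
    have := extDeriv₁_fields θ hX hY x
    simp only [hθ] at this
    simp at this
    linarith
  have β0 := fun {X Y : Π x : M, TangentSpace 𝓘(ℝ, E) x} (hX : SmoothField X)
    (hY : SmoothField Y) ↦ extDeriv₁_fields β hX hY x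
  simp only [extDeriv₂] at dd
  simp only [extDeriv₂, wedge₁₂, main hX hY hZ, main hY hX hZ, main hZ hX hY]
  simp only [hΩ, β0 hX hY, β0 hX hZ, β0 hY hZ, θ0 hX hY, θ0 hX hZ, θ0 hY hZ]
  -- `d(θ ∧ β - dβ) = -θ ∧ dβ - d(dβ)`, while `θ ∧ Ω = -θ ∧ dβ` because `θ ∧ θ = 0`. The two sides
  -- differ by `-d(dβ)` only.
  linear_combination -dd

end ExteriorDerivative

/-! ### Existence of Levi-Civita connections by a difference tensor -/

section LeviCivita

variable {E : Type*} [NormedAddCommGroup E] [NormedSpace ℝ E] [FiniteDimensional ℝ E]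
  {M : Type*} [TopologicalSpace M] [ChartedSpace E M] [IsManifold 𝓘(ℝ, E) ∞ M]

theorem Metric.mdiffAt (g : Metric E M) {Y Z : Π x : M, TangentSpace 𝓘(ℝ, E) x} {x : M}
    (hY : MDiffAt (T% Y) x) (hZ : MDiffAt (T% Z) x) :
    MDiffAt (fun y ↦ g.inner y (Y y) (Z y)) x := by
  have h1 : MDifferentiableAt 𝓘(ℝ, E) (𝓘(ℝ, E).prod 𝓘(ℝ, ℝ))
      (fun y ↦ TotalSpace.mk' ℝ (E := Bundle.Trivial M ℝ) y (g.inner y (Y y) (Z y))) x :=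
    MDifferentiableAt.clm_bundle_apply₂ (F₁ := E) (F₂ := E) (F₃ := ℝ) (E₃ := Bundle.Trivial M ℝ)
      (b := fun y : M ↦ y) ((g.contMDiff.mdifferentiable (by simp)) x) hY hZ
  exact (mdifferentiableAt_section (F := ℝ) (E := Bundle.Trivial M ℝ) 𝓘(ℝ, E) _).1 h1

/-- The linear form `v ↦ (D_v g)(Y, Z)`, for vector fields `Y` and `Z`. -/
noncomputable def derivMetricAux (D : AffineConnection E M) (g : Metric E M) (x : M)
    (Y Z : Π x : M, TangentSpace 𝓘(ℝ, E) x) : TangentSpace 𝓘(ℝ, E) x →L[ℝ] ℝ :=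
  mvfderiv 𝓘(ℝ, E) (fun y ↦ g.inner y (Y y) (Z y)) x - g.inner x (Z x) ∘L D Y x
    - g.inner x (Y x) ∘L D Z x

theorem derivMetricAux_swap (D : AffineConnection E M) (g : Metric E M) (x : M)
    (Y Z : Π x : M, TangentSpace 𝓘(ℝ, E) x) :
    derivMetricAux D g x Y Z = derivMetricAux D g x Z Y := by
  simp only [derivMetricAux, g.symm _ (Y _) (Z _)]
  abel

theorem derivMetricAux_tensorial (D : AffineConnection E M) (g : Metric E M) (x : M)
    (Z : Π x : M, TangentSpace 𝓘(ℝ, E) x) (hZ : MDiffAt (T% Z) x) :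
    TensorialAt 𝓘(ℝ, E) E (fun Y ↦ derivMetricAux D g x Y Z) x where
  smul {f Y} hf hY := by
    ext v
    have h := mvfderiv_fun_mul hf (g.mdiffAt hY hZ)
    simp [derivMetricAux, D.isCovariantDerivativeOn.leibniz hY hf, h, g.symm x (Z x)]
    ring
  add {Y Y'} hY hY' := by
    ext v
    have h := mvfderiv_fun_add (g.mdiffAt hY hZ) (g.mdiffAt hY' hZ)
    simp [derivMetricAux, D.isCovariantDerivativeOn.add hY hY', h]
    ring

theorem derivMetricAux_tensorial' (D : AffineConnection E M) (g : Metric E M) (x : M)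
    (Y : Π x : M, TangentSpace 𝓘(ℝ, E) x) (hY : MDiffAt (T% Y) x) :
    TensorialAt 𝓘(ℝ, E) E (fun Z ↦ derivMetricAux D g x Y Z) x := by
  simp only [derivMetricAux_swap D g x Y]
  exact derivMetricAux_tensorial D g x Y hY

/-- The tensor `D g`. -/
noncomputable def derivMetric (D : AffineConnection E M) (g : Metric E M) (x : M) :
    TangentSpace 𝓘(ℝ, E) x →L[ℝ] TangentSpace 𝓘(ℝ, E) x →L[ℝ] TangentSpace 𝓘(ℝ, E) x →L[ℝ] ℝ :=
  haveI : IsManifold 𝓘(ℝ, E) 1 M := isManifold_one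
  TensorialAt.mkHom₂ (derivMetricAux D g x) x (derivMetricAux_tensorial D g x)
    (derivMetricAux_tensorial' D g x)

theorem derivMetric_apply (D : AffineConnection E M) (g : Metric E M) {x : M}
    {Y Z : Π x : M, TangentSpace 𝓘(ℝ, E) x} (hY : MDiffAt (T% Y) x) (hZ : MDiffAt (T% Z) x) :
    derivMetric D g x (Y x) (Z x) = derivMetricAux D g x Y Z :=
  haveI : IsManifold 𝓘(ℝ, E) 1 M := isManifold_one
  TensorialAt.mkHom₂_apply (derivMetricAux_tensorial D g x) (derivMetricAux_tensorial' D g x) hY hZ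

theorem derivMetric_swap (D : AffineConnection E M) (g : Metric E M) (x : M)
    (v w : TangentSpace 𝓘(ℝ, E) x) : derivMetric D g x v w = derivMetric D g x w v :=
  derivMetricAux_swap D g x _ _

/-- The algebraic part of the Koszul formula. -/
theorem exists_koszul_aux {G : E →L[ℝ] E →L[ℝ] ℝ} (hG : Function.Bijective G)
    (T : E →L[ℝ] E →L[ℝ] E →L[ℝ] ℝ) :
    ∃ A : E →L[ℝ] E →L[ℝ] E, ∀ u v w, G (A u v) w = (T u w v + T v w u - T u v w) / 2 := by
  have hex : ∀ u v, ∃ a, ∀ w, G a w = (T u w v + T v w u - T u v w) / 2 := by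
    intro u v
    -- The last slot of `T` is the direction of differentiation, so the three terms are the cyclic
    -- Koszul terms.
    obtain ⟨a, ha⟩ := hG.2 ((1 / 2 : ℝ) • ((T u).flip v + (T v).flip u - T u v))
    refine ⟨a, fun w ↦ ?_⟩
    rw [ha]
    simp
    ring
  choose A hA using hex
  have hinj : ∀ a b, (∀ w, G a w = G b w) → a = b :=
    fun a b h ↦ hG.1 (ContinuousLinearMap.ext h)
  have T₁ : ∀ a b c d, T (a + b) c d = T a c d + T b c d := fun a b c d ↦ by rw [T.map_add]; rfl
  have T₂ : ∀ a b c d, T a (b + c) d = T a b d + T a c d :=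
    fun a b c d ↦ by rw [(T a).map_add]; rfl
  have T₃ : ∀ a b c d, T a b (c + d) = T a b c + T a b d := fun a b c d ↦ (T a b).map_add c d
  have S₁ : ∀ (r : ℝ) a b c, T (r • a) b c = r * T a b c := fun r a b c ↦ by rw [T.map_smul]; rfl
  have S₂ : ∀ (r : ℝ) a b c, T a (r • b) c = r * T a b c :=
    fun r a b c ↦ by rw [(T a).map_smul]; rfl
  have S₃ : ∀ (r : ℝ) a b c, T a b (r • c) = r * T a b c := fun r a b c ↦ (T a b).map_smul r c
  have G₁ : ∀ a b c, G (a + b) c = G a c + G b c := fun a b c ↦ by rw [G.map_add]; rfl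
  have G₂ : ∀ (r : ℝ) a b, G (r • a) b = r * G a b := fun r a b ↦ by rw [G.map_smul]; rfl
  -- The right-hand side is linear in `u` and in `v`, and `G` is injective, so the chosen values
  -- must be bilinear.
  have hbil : IsBilinearMap ℝ A :=
    { add_left := fun _ _ _ ↦ hinj _ _ fun w ↦ by simp only [G₁, hA, T₁, T₃]; ring
      smul_left := fun _ _ _ ↦ hinj _ _ fun w ↦ by simp only [G₂, hA, S₁, S₃]; ring
      add_right := fun _ _ _ ↦ hinj _ _ fun w ↦ by simp only [G₁, hA, T₁, T₂, T₃]; ring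
      smul_right := fun _ _ _ ↦ hinj _ _ fun w ↦ by simp only [G₂, hA, S₁, S₂, S₃]; ring }
  exact ⟨hbil.toLinearMap.toContinuousBilinearMap, hA⟩

/-- The tensor by which the Levi-Civita connection of `g` differs from a torsion-free connection. -/
theorem exists_koszul (D : AffineConnection E M) (g : Metric E M) (x : M) :
    ∃ A : TangentSpace 𝓘(ℝ, E) x →L[ℝ] TangentSpace 𝓘(ℝ, E) x →L[ℝ] TangentSpace 𝓘(ℝ, E) x,
      ∀ u v w, g.inner x (A u v) w = (derivMetric D g x u w v + derivMetric D g x v w u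
        - derivMetric D g x u v w) / 2 :=
  exists_koszul_aux (E := E) (metric_bijective g x) (derivMetric D g x)

/-- A metric has a Levi-Civita connection as soon as some metric has one. -/
theorem IsLeviCivita.exists_of_isLeviCivita {g₀ : Metric E M} {D : AffineConnection E M}
    (hD : IsLeviCivita g₀ D) (g : Metric E M) :
    ∃ D' : AffineConnection E M, IsLeviCivita g D' := by
  choose A hA using exists_koszul D g
  -- Symmetry of `A` keeps the torsion zero. The Koszul formula gives `g(A(u, v), w) + g(A(u, w), v)
  -- = (D_u g)(v, w)`, which compensates the failure of `D` to preserve `g`.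
  refine ⟨D.addOneForm A, ?_, ?_⟩
  · intro X Y x hX hY
    have hsymm : A x (Y x) (X x) = A x (X x) (Y x) := by
      refine (metric_bijective g x).1 (ContinuousLinearMap.ext fun w ↦ ?_)
      rw [hA, hA, derivMetric_swap D g x (Y x) (X x)]
      ring
    have := hD.torsion_free X Y x hX hY
    simp [CovariantDerivative.addOneForm, hsymm, this]
  · intro X Y Z x hY hZ
    have h := DFunLike.congr_fun (derivMetric_apply D g hY hZ) (X x)
    simp only [derivMetricAux] at h
    simp [g.symm x (Z x)] at h
    simp only [CovariantDerivative.addOneForm, dirDeriv]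
    simp only [map_add, add_apply, hA, g.symm x (Y x) (A _ _ _),
      derivMetric_swap D g x (Z x) (Y x), derivMetric_swap D g x (X x)] at h ⊢
    linarith

end LeviCivita

/-! ### Parallel forms and Killing fields -/

section Killing

variable {E : Type*} [NormedAddCommGroup E] [NormedSpace ℝ E] [FiniteDimensional ℝ E]
  {M : Type*} [TopologicalSpace M] [ChartedSpace E M] [IsManifold 𝓘(ℝ, E) ∞ M]

/-- The Lie derivative of `g` along `U` vanishes. -/
def IsKilling (g : Metric E M) (U : Π x : M, TangentSpace 𝓘(ℝ, E) x) : Prop :=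
  ∀ X Y : Π x : M, TangentSpace 𝓘(ℝ, E) x, SmoothField X → SmoothField Y → ∀ x : M,
    dirDeriv U (fun y ↦ g.inner y (X y) (Y y)) x =
      g.inner x (mlieBracket 𝓘(ℝ, E) U X x) (Y x) + g.inner x (X x) (mlieBracket 𝓘(ℝ, E) U Y x)

variable {g : Metric E M} {D : AffineConnection E M} {θ : OneForm E M}

/-- `(D_X θ)(Y) = g(D_X θ^#, Y)`. -/
theorem IsLeviCivita.parallel_eq (hD : IsLeviCivita g D) {X Y : Π x : M, TangentSpace 𝓘(ℝ, E) x}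
    {x : M} (hY : MDiffAt (T% Y) x) :
    dirDeriv X (fun y ↦ θ y (Y y)) x - θ x (D Y x (X x)) =
      g.inner x (D (sharp g θ) x (X x)) (Y x) := by
  have h := hD.metric X (sharp g θ) Y x ((smoothField_sharp g θ).mdiffAt x) hY
  simp only [inner_sharp] at h
  rw [h]
  ring

/-- Compatibility with `g` expands the derivative and vanishing torsion rewrites the brackets: `L_U
g` is the symmetrisation of `g(DU, ·)`. -/
theorem IsLeviCivita.killing_eq (hD : IsLeviCivita g D) {U X Y : Π x : M, TangentSpace 𝓘(ℝ, E) x}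
    (hU : SmoothField U) (hX : SmoothField X) (hY : SmoothField Y) (x : M) :
    dirDeriv U (fun y ↦ g.inner y (X y) (Y y)) x - g.inner x (mlieBracket 𝓘(ℝ, E) U X x) (Y x)
      - g.inner x (X x) (mlieBracket 𝓘(ℝ, E) U Y x) =
      g.inner x (D U x (X x)) (Y x) + g.inner x (D U x (Y x)) (X x) := by
  have h := hD.metric U X Y x (hX.mdiffAt x) (hY.mdiffAt x)
  have h1 := hD.torsion_free U X x (hU.mdiffAt x) (hX.mdiffAt x)
  have h2 := hD.torsion_free U Y x (hU.mdiffAt x) (hY.mdiffAt x)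
  rw [h, ← h1, ← h2, g.symm x (D U x (Y x)) (X x)]
  simp only [map_sub, sub_apply]
  ring

variable [T2Space M]

theorem IsParallel.isKilling (hD : IsLeviCivita g D) (h : IsParallel D θ) :
    IsKilling g (sharp g θ) := by
  intro X Y hX hY x
  have h1 := hD.killing_eq (smoothField_sharp g θ) hX hY x
  rw [← hD.parallel_eq (hY.mdiffAt x), ← hD.parallel_eq (hX.mdiffAt x),
    h X Y x (hY.mdiffAt x), h Y X x (hX.mdiffAt x)] at h1
  linarith

/-- The form `g(D_X θ^#, Y)` is symmetric because `θ` is closed and skew because `θ^#` is Killing,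
so it vanishes. This allows parallelism to be checked without computing a connection. -/
theorem IsKilling.isParallel (hD : IsLeviCivita g D) (hθ : extDeriv₁ θ = 0)
    (h : IsKilling g (sharp g θ)) : IsParallel D θ := by
  intro X₀ Y₀ x hY₀
  rw [hD.parallel_eq hY₀]
  obtain ⟨X, hX, hXx⟩ := exists_smoothField x (X₀ x)
  obtain ⟨Y, hY, hYx⟩ := exists_smoothField x (Y₀ x)
  rw [← hXx, ← hYx]
  have h1 := hD.killing_eq (smoothField_sharp g θ) hX hY x
  rw [h X Y hX hY x] at h1
  have h2 := extDeriv₁_fields θ hX hY x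
  have h3 := hD.parallel_eq (θ := θ) (X := X) (hY.mdiffAt x)
  have h4 := hD.parallel_eq (θ := θ) (X := Y) (hX.mdiffAt x)
  have h5 := congrArg (θ x) (hD.torsion_free X Y x (hX.mdiffAt x) (hY.mdiffAt x))
  rw [map_sub] at h5
  rw [hθ] at h2
  simp at h2
  linarith

end Killing

/-! ### The Lee field is Killing and holomorphic -/

namespace VaismanStructure

variable {E : Type*} [NormedAddCommGroup E] [NormedSpace ℝ E] [FiniteDimensional ℝ E]
  {M : Type*} [TopologicalSpace M] [ChartedSpace E M] [IsManifold 𝓘(ℝ, E) ∞ M]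
  (S : VaismanStructure E M)

theorem inner_U (x : M) (v : TangentSpace 𝓘(ℝ, E) x) : S.g.inner x (S.U x) v = S.θ x v :=
  inner_sharp _ _ _ _

theorem θ_U (x : M) : S.θ x (S.U x) = 1 := by
  rw [← S.inner_U]
  exact S.unit x

theorem J_J (x : M) (v : TangentSpace 𝓘(ℝ, E) x) : S.J x (S.J x v) = -v := S.complex.sq x v

theorem J_U (x : M) : S.J x (S.U x) = S.V x := rfl

theorem J_V (x : M) : S.J x (S.V x) = - S.U x := S.J_J x _

theorem θc_apply (x : M) (v : TangentSpace 𝓘(ℝ, E) x) : S.θc x v = - S.θ x (S.J x v) := rfl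

theorem θ_J (x : M) (v : TangentSpace 𝓘(ℝ, E) x) : S.θ x (S.J x v) = - S.θc x v := by
  rw [θc_apply, neg_neg]

theorem θc_J (x : M) (v : TangentSpace 𝓘(ℝ, E) x) : S.θc x (S.J x v) = S.θ x v := by
  rw [θc_apply, J_J, map_neg, neg_neg]

theorem inner_J (x : M) (v w : TangentSpace 𝓘(ℝ, E) x) :
    S.g.inner x (S.J x v) w = - S.g.inner x v (S.J x w) := by
  rw [← S.hermitian x v, J_J, map_neg, neg_neg]

theorem inner_V (x : M) (v : TangentSpace 𝓘(ℝ, E) x) : S.g.inner x (S.V x) v = S.θc x v := by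
  rw [← J_U, inner_J, inner_U, θc_apply]

theorem θ_V (x : M) : S.θ x (S.V x) = 0 := by
  have h := S.inner_J x (S.U x) (S.U x)
  rw [J_U, S.g.symm, inner_U] at h
  linarith

theorem θc_U (x : M) : S.θc x (S.U x) = 0 := by
  rw [θc_apply, J_U, θ_V, neg_zero]

theorem θc_V (x : M) : S.θc x (S.V x) = 1 := by
  rw [← J_U, θc_J, θ_U]

theorem smoothField_U : SmoothField S.U := smoothField_sharp _ _

theorem smoothField_V : SmoothField S.V := S.smoothField_U.endField S.J

variable {S} in
-- On a leaf, `θ` and `θ^c` form the basis dual to `U`, `V`.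
theorem eq_smul_of_mem_leaf {x : M} {v : TangentSpace 𝓘(ℝ, E) x} (hv : v ∈ S.leaf x) :
    v = S.θ x v • S.U x + S.θc x v • S.V x := by
  obtain ⟨a, b, rfl⟩ := Submodule.mem_span_pair.1 hv
  simp [θ_U, θ_V, θc_U, θc_V]

theorem U_mem_leaf (x : M) : S.U x ∈ S.leaf x := Submodule.subset_span (by simp)

theorem V_mem_leaf (x : M) : S.V x ∈ S.leaf x := Submodule.subset_span (by simp)

theorem mem_normal_iff {x : M} {v : TangentSpace 𝓘(ℝ, E) x} :
    v ∈ S.normal x ↔ S.θ x v = 0 ∧ S.θc x v = 0 := by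
  constructor
  · intro h
    exact ⟨by rw [← inner_U]; exact h _ (S.U_mem_leaf x),
      by rw [← inner_V]; exact h _ (S.V_mem_leaf x)⟩
  · rintro ⟨h1, h2⟩ u hu
    rw [eq_smul_of_mem_leaf hu]
    simp [inner_U, inner_V, h1, h2]

variable [T2Space M]

theorem isKilling_U : IsKilling S.g S.U := by
  obtain ⟨D, hD, hθ⟩ := S.parallel
  exact hθ.isKilling hD

section

variable {X Y Z : Π x : M, TangentSpace 𝓘(ℝ, E) x}

/-- `L_U ω = g((L_U J) ·, ·)`. -/
theorem lieDeriv_U_form (hY : SmoothField Y) (hZ : SmoothField Z) (x : M) :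
    S.g.inner x (mlieBracket 𝓘(ℝ, E) S.U (fun y ↦ S.J y (Y y)) x
        - S.J x (mlieBracket 𝓘(ℝ, E) S.U Y x)) (Z x) =
      extDeriv₁ S.θc x (Y x) (Z x) + S.g.inner x (S.J x (Y x)) (Z x)
        - S.θ x (Y x) * S.θc x (Z x) + S.θ x (Z x) * S.θc x (Y x) := by
  -- Cartan's formula: `L_U ω = ι_U(θ ∧ ω) + d(ι_U ω)` with `ι_U ω = θ^c`. The Killing property
  -- moves the derivative onto `J`.
  have h := S.lck S.U Y Z S.smoothField_U hY hZ x
  have hK := S.isKilling_U _ _ (hY.endField S.J) hZ x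
  simp only [extDeriv₂, wedge₁₂, fundamentalForm, ContinuousLinearMap.comp_apply, J_U, inner_V,
    θ_U] at h
  rw [extDeriv₁_fields _ hY hZ, map_sub, sub_apply]
  have h1 := S.inner_J x (mlieBracket 𝓘(ℝ, E) S.U Z x) (Y x)
  rw [S.g.symm x _ (S.J x (Y x))] at h1
  have h2 := S.inner_J x (mlieBracket 𝓘(ℝ, E) Y Z x) (S.U x)
  rw [J_U, S.g.symm x _ (S.V x), inner_V] at h2
  linarith

/-- `L_V ω = 0`. -/
theorem lieDeriv_V_form (hY : SmoothField Y) (hZ : SmoothField Z) (x : M) :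
    dirDeriv S.V (fun y ↦ S.g.inner y (S.J y (Y y)) (Z y)) x =
      S.g.inner x (S.J x (mlieBracket 𝓘(ℝ, E) S.V Y x)) (Z x)
        + S.g.inner x (S.J x (Y x)) (mlieBracket 𝓘(ℝ, E) S.V Z x) := by
  -- Here `ι_V ω = -θ` and `θ(V) = 0`, so Cartan's formula gives `θ ∧ θ - dθ = 0`.
  have h := S.lck S.V Y Z S.smoothField_V hY hZ x
  have hθ : extDeriv₁ S.θ x (Y x) (Z x) = 0 := by rw [S.closed]; rfl
  rw [extDeriv₁_fields S.θ hY hZ] at hθ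
  simp only [extDeriv₂, wedge₁₂, fundamentalForm, ContinuousLinearMap.comp_apply, J_V,
    θ_V, map_neg, neg_apply, inner_U, dirDeriv_neg] at h
  have h1 := S.inner_J x (mlieBracket 𝓘(ℝ, E) S.V Z x) (Y x)
  rw [S.g.symm x _ (S.J x (Y x))] at h1
  have h2 := S.inner_J x (mlieBracket 𝓘(ℝ, E) Y Z x) (S.V x)
  rw [J_V, map_neg, S.g.symm x _ (S.U x), inner_U] at h2
  linarith

/-- Integrability with `U` as one argument reads `L_{JU} J = J ∘ L_U J`. -/
theorem mlieBracket_V_J_eq (hY : SmoothField Y) (x : M) :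
    mlieBracket 𝓘(ℝ, E) S.V (fun y ↦ S.J y (Y y)) x - S.J x (mlieBracket 𝓘(ℝ, E) S.V Y x) =
      S.J x (mlieBracket 𝓘(ℝ, E) S.U (fun y ↦ S.J y (Y y)) x
        - S.J x (mlieBracket 𝓘(ℝ, E) S.U Y x)) := by
  have h := S.complex.nijenhuis S.U Y S.smoothField_U hY x
  have hV : (fun y ↦ S.J y (S.U y)) = S.V := rfl
  rw [hV] at h
  rw [map_sub, J_J, ← sub_eq_zero, ← h]
  abel

/-- The Lee field is holomorphic. -/
theorem mlieBracket_U_J (hY : SmoothField Y) (x : M) :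
    mlieBracket 𝓘(ℝ, E) S.U (fun y ↦ S.J y (Y y)) x = S.J x (mlieBracket 𝓘(ℝ, E) S.U Y x) := by
  rw [← sub_eq_zero]
  -- By `L_V ω = 0` the tensor `g((L_U J) ·, ·)` is symmetric, and `L_U ω` is skew-symmetric.
  have key : ∀ {Y Z : Π x : M, TangentSpace 𝓘(ℝ, E) x}, SmoothField Y → SmoothField Z →
      dirDeriv S.V (fun y ↦ S.g.inner y (S.J y (Y y)) (S.J y (Z y))) x
        - S.g.inner x (mlieBracket 𝓘(ℝ, E) S.V (fun y ↦ S.J y (Y y)) x) (S.J x (Z x))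
        - S.g.inner x (S.J x (Y x)) (mlieBracket 𝓘(ℝ, E) S.V (fun y ↦ S.J y (Z y)) x) =
      - S.g.inner x (mlieBracket 𝓘(ℝ, E) S.U (fun y ↦ S.J y (Y y)) x
        - S.J x (mlieBracket 𝓘(ℝ, E) S.U Y x)) (Z x) := by
    intro Y Z hY hZ
    rw [S.lieDeriv_V_form hY (hZ.endField S.J), ← S.hermitian x _ (Z x),
      ← S.mlieBracket_V_J_eq hY, map_sub (S.g.inner x), sub_apply]
    ring
  -- `Z` extends the vector `(L_U J) Y` at `x`: a form both symmetric and skew gives this vector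
  -- length zero.
  obtain ⟨Z, hZ, hZx⟩ := exists_smoothField x (mlieBracket 𝓘(ℝ, E) S.U (fun y ↦ S.J y (Y y)) x
    - S.J x (mlieBracket 𝓘(ℝ, E) S.U Y x))
  have h1 := key hY hZ
  have h2 := key hZ hY
  have h3 := S.lieDeriv_U_form hY hZ x
  have h4 := S.lieDeriv_U_form hZ hY x
  have hs : (fun y ↦ S.g.inner y (S.J y (Z y)) (S.J y (Y y))) =
      fun y ↦ S.g.inner y (S.J y (Y y)) (S.J y (Z y)) := funext fun y ↦ S.g.symm y _ _
  rw [hs, S.g.symm x (mlieBracket 𝓘(ℝ, E) S.V (fun y ↦ S.J y (Z y)) x),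
    S.g.symm x (S.J x (Z x))] at h2
  rw [extDeriv₁_swap, inner_J, S.g.symm x (Z x)] at h4
  by_contra hne
  have hpos := S.g.pos x _ hne
  nth_rw 2 [← hZx] at hpos
  linarith

theorem mlieBracket_V_J (hY : SmoothField Y) (x : M) :
    mlieBracket 𝓘(ℝ, E) S.V (fun y ↦ S.J y (Y y)) x = S.J x (mlieBracket 𝓘(ℝ, E) S.V Y x) := by
  have h := S.mlieBracket_V_J_eq hY x
  rwa [S.mlieBracket_U_J hY, sub_self, map_zero, sub_eq_zero] at h

theorem mlieBracket_U_V (x : M) : mlieBracket 𝓘(ℝ, E) S.U S.V x = 0 := by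
  have := S.mlieBracket_U_J S.smoothField_U x
  simpa using! this

end

/-- Holomorphy of `U` makes `L_U ω` vanish, and Cartan's formula becomes `ω = θ ∧ θ^c + ω₀`. -/
theorem omega₀_apply (x : M) (v w : TangentSpace 𝓘(ℝ, E) x) :
    S.omega₀ x v w = S.g.inner x (S.J x v) w - S.θ x v * S.θc x w + S.θ x w * S.θc x v := by
  obtain ⟨X, hX, rfl⟩ := exists_smoothField x v
  obtain ⟨Y, hY, rfl⟩ := exists_smoothField x w
  have := S.lieDeriv_U_form hX hY x
  rw [S.mlieBracket_U_J hX, sub_self] at this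
  have h2 : S.omega₀ x (X x) (Y x) = - extDeriv₁ S.θc x (X x) (Y x) := rfl
  simp at this
  linarith

end VaismanStructure

/-! ### Linear algebra of positive bilinear forms -/

section Linear

variable {E : Type*} [NormedAddCommGroup E] [NormedSpace ℝ E]

/-- The bilinear form `B(·, J ·)`. -/
noncomputable def compRight (B : E →L[ℝ] E →L[ℝ] ℝ) (J : E →L[ℝ] E) : E →L[ℝ] E →L[ℝ] ℝ :=
  ((ContinuousLinearMap.compL ℝ E E ℝ).flip J).comp B

/-- The rank one bilinear form `α ⊗ α`. -/
noncomputable def tensorSelf (α : E →L[ℝ] ℝ) : E →L[ℝ] E →L[ℝ] ℝ := α.smulRight α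

/-- On the compact unit sphere `B(v, v)` has a positive minimum `m`, so `B(v, v) ≥ m‖v‖²`. The bound
is part of the data of a Riemannian metric. -/
theorem isVonNBounded_of_pos [FiniteDimensional ℝ E] (B : E →L[ℝ] E →L[ℝ] ℝ)
    (hB : ∀ v, v ≠ 0 → 0 < B v v) : Bornology.IsVonNBounded ℝ {v : E | B v v < 1} := by
  rcases subsingleton_or_nontrivial E with h | h
  · rw [NormedSpace.isVonNBounded_iff]
    exact (Set.toFinite _).isBounded
  have : ProperSpace E := FiniteDimensional.proper ℝ E
  obtain ⟨u, hu, hmin⟩ := (isCompact_sphere (0 : E) 1).exists_isMinOn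
    (NormedSpace.sphere_nonempty.2 zero_le_one)
    (f := fun v ↦ B v v) (B.continuous.clm_apply continuous_id).continuousOn
  have hu0 : u ≠ 0 := by
    rintro rfl
    simp at hu
  have hm := hB u hu0
  have hle : ∀ v : E, B u u * ‖v‖ ^ 2 ≤ B v v := by
    intro v
    by_cases hv : v = 0
    · simp [hv]
    have hn : ‖v‖ ≠ 0 := norm_ne_zero_iff.2 hv
    have h1 : B u u ≤ B (‖v‖⁻¹ • v) (‖v‖⁻¹ • v) :=
      hmin (by simp [norm_smul, hn])
    simp only [map_smul, smul_apply, smul_eq_mul] at h1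
    have h2 := mul_le_mul_of_nonneg_right h1 (sq_nonneg ‖v‖)
    calc _ ≤ _ := h2
      _ = _ := by field_simp
  rw [NormedSpace.isVonNBounded_iff, isBounded_iff_forall_norm_le]
  -- From `t ≤ 1 + t²` and `‖v‖² ≤ m⁻¹`, where `m = B u u`.
  refine ⟨1 + (B u u)⁻¹, fun v hv ↦ ?_⟩
  have h3 : ‖v‖ ^ 2 ≤ (B u u)⁻¹ := by
    rw [inv_eq_one_div, le_div_iff₀ hm, mul_comm]
    exact (hle v).trans hv.le
  nlinarith [sq_nonneg (‖v‖ - 1)]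

end Linear

/-! ### Nijenhuis tensors and invariance under a flow -/

section

variable {E : Type*} [NormedAddCommGroup E] [NormedSpace ℝ E] [FiniteDimensional ℝ E]
  {M : Type*} [TopologicalSpace M] [ChartedSpace E M] [IsManifold 𝓘(ℝ, E) ∞ M]

theorem Metric.ext_inner {g g' : Metric E M}
    (h : ∀ (x : M) (v w : TangentSpace 𝓘(ℝ, E) x), g.inner x v w = g'.inner x v w) : g = g' := by
  have : g.inner = g'.inner := funext fun x ↦ ContinuousLinearMap.ext fun v ↦
    ContinuousLinearMap.ext fun w ↦ h x v w
  cases g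
  cases g'
  congr

variable [T2Space M]

theorem extDeriv₁_sub (α β : OneForm E M) (x : M) (v w : TangentSpace 𝓘(ℝ, E) x) :
    extDeriv₁ (α - β) x v w = extDeriv₁ α x v w - extDeriv₁ β x v w := by
  have := extDeriv₁_add (α - β) β x v w
  rw [sub_add_cancel] at this
  linarith

variable {X Y Z : Π x : M, TangentSpace 𝓘(ℝ, E) x}

/-- The Nijenhuis tensor of `J` takes values in the kernel of `θ` and `β = -θ ∘ J` if `θ` is closed
and `dβ` is of type `(1,1)`. -/
theorem apply_nijenhuis_eq_zero {J : EndField E M} {θ β : OneForm E M} (hθ : extDeriv₁ θ = 0)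
    (hθJ : ∀ (x : M) (v : TangentSpace 𝓘(ℝ, E) x), θ x (J x v) = - β x v)
    (hβJ : ∀ (x : M) (v : TangentSpace 𝓘(ℝ, E) x), β x (J x v) = θ x v)
    (hJ : ∀ (x : M) (v : TangentSpace 𝓘(ℝ, E) x), J x (J x v) = -v)
    (hβ : ∀ (x : M) (v w : TangentSpace 𝓘(ℝ, E) x),
      extDeriv₁ β x (J x v) (J x w) = extDeriv₁ β x v w)
    (hX : SmoothField X) (hY : SmoothField Y) (x : M) :
    θ x (mlieBracket 𝓘(ℝ, E) (fun y ↦ J y (X y)) (fun y ↦ J y (Y y)) x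
      - J x (mlieBracket 𝓘(ℝ, E) (fun y ↦ J y (X y)) Y x)
      - J x (mlieBracket 𝓘(ℝ, E) X (fun y ↦ J y (Y y)) x)
      - mlieBracket 𝓘(ℝ, E) X Y x) = 0 ∧
    β x (mlieBracket 𝓘(ℝ, E) (fun y ↦ J y (X y)) (fun y ↦ J y (Y y)) x
      - J x (mlieBracket 𝓘(ℝ, E) (fun y ↦ J y (X y)) Y x)
      - J x (mlieBracket 𝓘(ℝ, E) X (fun y ↦ J y (Y y)) x)
      - mlieBracket 𝓘(ℝ, E) X Y x) = 0 := by
  have hJX := hX.endField J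
  have hJY := hY.endField J
  have hθ' : ∀ (x : M) (v w : TangentSpace 𝓘(ℝ, E) x), extDeriv₁ θ x v w = 0 := fun x v w ↦ by
    rw [hθ]; rfl
  have hβ' : extDeriv₁ β x (X x) (J x (Y x)) = - extDeriv₁ β x (J x (X x)) (Y x) := by
    rw [← hβ x (X x), hJ, map_neg]
  -- With `θ ∘ J = -β` and `β ∘ J = θ`, the function derivatives cancel. Up to `dθ`-terms, `θ(N)` is
  -- `-(dβ(JX, Y) + dβ(X, JY))` and `β(N)` is `-(dβ(JX, JY) - dβ(X, Y))`.
  have t1 := extDeriv₁_fields θ hJX hJY x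
  have t2 := extDeriv₁_fields θ hJX hY x
  have t3 := extDeriv₁_fields θ hX hJY x
  have t4 := extDeriv₁_fields θ hX hY x
  have b1 := extDeriv₁_fields β hJX hJY x
  have b2 := extDeriv₁_fields β hJX hY x
  have b3 := extDeriv₁_fields β hX hJY x
  have b4 := extDeriv₁_fields β hX hY x
  simp only [hθ', hθJ, hβJ, hβ, dirDeriv_neg, hβ'] at t1 t2 t3 t4 b1 b2 b3 b4
  simp only [map_sub, hθJ, hβJ]
  constructor <;> linarith

/-- A closed 2-form `dβ` with `ι_U dβ = 0` is invariant under the flow of `U`. -/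
theorem dirDeriv_extDeriv₁ {U : Π x : M, TangentSpace 𝓘(ℝ, E) x} (hU : SmoothField U)
    {β : OneForm E M} (hβ : ∀ (x : M) (v : TangentSpace 𝓘(ℝ, E) x), extDeriv₁ β x (U x) v = 0)
    (hX : SmoothField X) (hY : SmoothField Y) (x : M) :
    dirDeriv U (fun y ↦ extDeriv₁ β y (X y) (Y y)) x =
      extDeriv₁ β x (mlieBracket 𝓘(ℝ, E) U X x) (Y x)
        + extDeriv₁ β x (X x) (mlieBracket 𝓘(ℝ, E) U Y x) := by
  have h := extDeriv₂_extDeriv₁ β hU hX hY x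
  simp only [extDeriv₂, hβ, dirDeriv_const] at h
  rw [extDeriv₁_swap β x (mlieBracket 𝓘(ℝ, E) U Y x), extDeriv₁_swap β x _ (U x), hβ] at h
  linarith

end

/-! ### Basic forms and brackets modulo the foliation -/

namespace VaismanStructure

variable {E : Type*} [NormedAddCommGroup E] [NormedSpace ℝ E] [FiniteDimensional ℝ E]
  {M : Type*} [TopologicalSpace M] [ChartedSpace E M] [IsManifold 𝓘(ℝ, E) ∞ M] [T2Space M]
  (S : VaismanStructure E M) {X Y Z : Π x : M, TangentSpace 𝓘(ℝ, E) x}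

theorem omega₀_swap (x : M) (v w : TangentSpace 𝓘(ℝ, E) x) : S.omega₀ x v w = - S.omega₀ x w v := by
  simp only [omega₀, Pi.neg_apply, neg_apply, extDeriv₁_swap S.θc x v w]

theorem omega₀_U (x : M) (w : TangentSpace 𝓘(ℝ, E) x) : S.omega₀ x (S.U x) w = 0 := by
  rw [omega₀_apply, J_U, inner_V, θ_U, θc_U]
  ring

theorem omega₀_V (x : M) (w : TangentSpace 𝓘(ℝ, E) x) : S.omega₀ x (S.V x) w = 0 := by
  rw [omega₀_apply, J_V, map_neg, neg_apply, inner_U, θ_V, θc_V]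
  ring

theorem omega₀_J_J (x : M) (v w : TangentSpace 𝓘(ℝ, E) x) :
    S.omega₀ x (S.J x v) (S.J x w) = S.omega₀ x v w := by
  rw [omega₀_apply, omega₀_apply, S.hermitian, θ_J, θ_J, θc_J, θc_J]
  ring

theorem extDeriv₁_θc (x : M) (v w : TangentSpace 𝓘(ℝ, E) x) :
    extDeriv₁ S.θc x v w = - S.omega₀ x v w := by
  simp [omega₀]

/-- If `ζ(X) = 0` then `L_X ζ = ι_X dζ`, which is tensorial in `X`. Only the generators `U` and `V`
have to be tested. -/
theorem isBasic_iff (ζ : OneForm E M) : S.IsBasic ζ ↔ ∀ x : M, ζ x (S.U x) = 0 ∧ ζ x (S.V x) = 0 ∧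
    ∀ v : TangentSpace 𝓘(ℝ, E) x,
      extDeriv₁ ζ x (S.U x) v = 0 ∧ extDeriv₁ ζ x (S.V x) v = 0 := by
  constructor
  · intro h x
    have key : ∀ {X : Π x : M, TangentSpace 𝓘(ℝ, E) x}, SmoothField X → (∀ x, X x ∈ S.leaf x) →
        ∀ v, extDeriv₁ ζ x (X x) v = 0 := by
      intro X hX hXl v
      obtain ⟨Y, hY, rfl⟩ := exists_smoothField x v
      obtain ⟨h1, h2⟩ := h X hX hXl
      have h3 := h2 Y hY x
      simp only [lieDeriv₁] at h3
      simp only [extDeriv₁_fields ζ hX hY, h1, dirDeriv_const]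
      linarith
    exact ⟨(h S.U S.smoothField_U S.U_mem_leaf).1 x, (h S.V S.smoothField_V S.V_mem_leaf).1 x,
      fun v ↦ ⟨key S.smoothField_U S.U_mem_leaf v, key S.smoothField_V S.V_mem_leaf v⟩⟩
  · intro h X hX hXl
    have h1 : ∀ x, ζ x (X x) = 0 := fun x ↦ by
      rw [eq_smul_of_mem_leaf (hXl x)]
      simp [(h x).1, (h x).2.1]
    refine ⟨h1, fun Y hY x ↦ ?_⟩
    have h2 := extDeriv₁_fields ζ hX hY x
    have h3 : extDeriv₁ ζ x (X x) (Y x) = 0 := by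
      rw [eq_smul_of_mem_leaf (hXl x)]
      simp [((h x).2.2 _).1, ((h x).2.2 _).2]
    simp only [h1, dirDeriv_const, h3] at h2
    simp only [lieDeriv₁]
    linarith

theorem J_mem_leaf {x : M} {v : TangentSpace 𝓘(ℝ, E) x} (hv : v ∈ S.leaf x) :
    S.J x v ∈ S.leaf x := by
  rw [eq_smul_of_mem_leaf hv, map_add, map_smul, map_smul, J_U, J_V]
  exact add_mem (Submodule.smul_mem _ _ (S.V_mem_leaf x))
    (Submodule.smul_mem _ _ (neg_mem (S.U_mem_leaf x)))

/-- The Lie bracket with a vector field changed by a field tangent to the foliation. -/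
theorem mlieBracket_add_leaf_left {f h : M → ℝ} (hf : SmoothFun (E := E) f)
    (hh : SmoothFun (E := E) h) (hX : SmoothField X) (x : M) :
    mlieBracket 𝓘(ℝ, E) (fun y ↦ X y + f y • S.U y + h y • S.V y) Y x
      - (mlieBracket 𝓘(ℝ, E) X Y x + f x • mlieBracket 𝓘(ℝ, E) S.U Y x
        + h x • mlieBracket 𝓘(ℝ, E) S.V Y x) ∈ S.leaf x := by
  have : CompleteSpace E := FiniteDimensional.complete ℝ E
  have : IsManifold 𝓘(ℝ, E) (minSmoothness ℝ 2) M := by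
    simpa using! (.of_le (n := ∞) (by norm_cast))
  have hfU := SmoothField.smul hf S.smoothField_U
  have hhV := SmoothField.smul hh S.smoothField_V
  have e1 := mlieBracket_add_left (W := Y) ((hX.add hfU).mdiffAt x) (hhV.mdiffAt x)
  have e2 := mlieBracket_add_left (W := Y) (hX.mdiffAt x) (hfU.mdiffAt x)
  have e3 := mlieBracket_smul_left (W := Y) (hf.mdiffAt x) (S.smoothField_U.mdiffAt x)
  have e4 := mlieBracket_smul_left (W := Y) (hh.mdiffAt x) (S.smoothField_V.mdiffAt x)
  have e : mlieBracket 𝓘(ℝ, E) (fun y ↦ X y + f y • S.U y + h y • S.V y) Y x = _ := e1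
  have e2' : mlieBracket 𝓘(ℝ, E) (fun y ↦ X y + f y • S.U y) Y x = _ := e2
  have e3' : mlieBracket 𝓘(ℝ, E) (fun y ↦ f y • S.U y) Y x = _ := e3
  have e4' : mlieBracket 𝓘(ℝ, E) (fun y ↦ h y • S.V y) Y x = _ := e4
  rw [e, e2', e3', e4']
  convert add_mem (Submodule.smul_mem _ (-(mvfderiv 𝓘(ℝ, E) f x (Y x))) (S.U_mem_leaf x))
    (Submodule.smul_mem _ (-(mvfderiv 𝓘(ℝ, E) h x (Y x))) (S.V_mem_leaf x)) using 1
  module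

theorem mlieBracket_add_leaf_right {f h : M → ℝ} (hf : SmoothFun (E := E) f)
    (hh : SmoothFun (E := E) h) (hX : SmoothField X) (x : M) :
    mlieBracket 𝓘(ℝ, E) Y (fun y ↦ X y + f y • S.U y + h y • S.V y) x
      - (mlieBracket 𝓘(ℝ, E) Y X x + f x • mlieBracket 𝓘(ℝ, E) Y S.U x
        + h x • mlieBracket 𝓘(ℝ, E) Y S.V x) ∈ S.leaf x := by
  rw [mlieBracket_swap_apply, mlieBracket_swap_apply (W := X), mlieBracket_swap_apply (W := S.U),
    mlieBracket_swap_apply (W := S.V)]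
  convert neg_mem (S.mlieBracket_add_leaf_left hf hh hX x) using 1
  module

/-- If `J'` differs from `J` by fields tangent to the foliation, then so do the Nijenhuis tensors. -/
theorem nijenhuis_mem_leaf {J' : EndField E M} {a b : OneForm E M}
    (hJ' : ∀ (x : M) (v : TangentSpace 𝓘(ℝ, E) x),
      J' x v = S.J x v + a x v • S.U x + b x v • S.V x)
    (hX : SmoothField X) (hY : SmoothField Y) (x : M) :
    mlieBracket 𝓘(ℝ, E) (fun y ↦ J' y (X y)) (fun y ↦ J' y (Y y)) x
      - J' x (mlieBracket 𝓘(ℝ, E) (fun y ↦ J' y (X y)) Y x)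
      - J' x (mlieBracket 𝓘(ℝ, E) X (fun y ↦ J' y (Y y)) x)
      - mlieBracket 𝓘(ℝ, E) X Y x ∈ S.leaf x := by
  have hJX := hX.endField S.J
  have hJY := hY.endField S.J
  have haX := a.smoothFun hX
  have hbX := b.smoothFun hX
  have haY := a.smoothFun hY
  have hbY := b.smoothFun hY
  have eX : (fun y ↦ J' y (X y)) = fun y ↦ S.J y (X y) + a y (X y) • S.U y + b y (X y) • S.V y :=
    funext fun y ↦ hJ' y _
  have eY : (fun y ↦ J' y (Y y)) = fun y ↦ S.J y (Y y) + a y (Y y) • S.U y + b y (Y y) • S.V y :=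
    funext fun y ↦ hJ' y _
  have hUV := S.mlieBracket_U_V x
  have hVU : mlieBracket 𝓘(ℝ, E) S.V S.U x = 0 := by rw [mlieBracket_swap_apply, hUV, neg_zero]
  have hUU : mlieBracket 𝓘(ℝ, E) S.U S.U x = 0 := by simp
  have hVV : mlieBracket 𝓘(ℝ, E) S.V S.V x = 0 := by simp
  -- Modulo the leaf, the coefficients come out of the brackets. Since `U` and `V` commute with each
  -- other and preserve `J`, the terms `a(X) J[U, Y]` and their analogues occur twice with opposite
  -- signs, and the Nijenhuis tensor of `J` remains.
  have l1 := S.mlieBracket_add_leaf_left (Y := fun y ↦ J' y (Y y)) haX hbX hJX x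
  have l2 := S.mlieBracket_add_leaf_right (Y := fun y ↦ S.J y (X y)) haY hbY hJY x
  have l3 := S.mlieBracket_add_leaf_right (Y := S.U) haY hbY hJY x
  have l4 := S.mlieBracket_add_leaf_right (Y := S.V) haY hbY hJY x
  have l5 := S.J_mem_leaf (S.mlieBracket_add_leaf_left (Y := Y) haX hbX hJX x)
  have l6 := S.J_mem_leaf (S.mlieBracket_add_leaf_right (Y := X) haY hbY hJY x)
  rw [← eX] at l1 l5
  rw [← eY] at l2 l3 l4 l6
  rw [S.mlieBracket_U_J hY, hUU, hUV] at l3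
  rw [S.mlieBracket_V_J hY, hVU, hVV] at l4
  rw [mlieBracket_swap_apply (W := S.U), mlieBracket_swap_apply (W := S.V), S.mlieBracket_U_J hX,
    S.mlieBracket_V_J hX] at l2
  rw [mlieBracket_swap_apply (V := X) (W := S.U), mlieBracket_swap_apply (V := X) (W := S.V)] at l6
  have hN := S.complex.nijenhuis X Y hX hY x
  have mem : ∀ v, J' x v - S.J x v ∈ S.leaf x := fun v ↦ by
    rw [hJ', add_assoc, add_sub_cancel_left]
    exact add_mem (Submodule.smul_mem _ _ (S.U_mem_leaf x))
      (Submodule.smul_mem _ _ (S.V_mem_leaf x))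
  have m1 := mem (mlieBracket 𝓘(ℝ, E) (fun y ↦ J' y (X y)) Y x)
  have m2 := mem (mlieBracket 𝓘(ℝ, E) X (fun y ↦ J' y (Y y)) x)
  simp only [map_sub, map_add, map_smul, map_neg] at l5 l6
  have total := sub_mem (sub_mem (sub_mem (sub_mem (add_mem (add_mem (add_mem l1 l2)
    (Submodule.smul_mem _ (a x (X x)) l3)) (Submodule.smul_mem _ (b x (X x)) l4)) l5) l6) m1) m2
  have hN0 := (S.leaf x).zero_mem
  rw [← hN] at hN0
  convert add_mem total hN0 using 1
  simp only [smul_zero, add_zero]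
  module

end VaismanStructure

/-! ### Construction of the deformation from `ζ` -/

namespace VaismanStructure

variable {E : Type*} [NormedAddCommGroup E] [NormedSpace ℝ E] [FiniteDimensional ℝ E]
  {M : Type*} [TopologicalSpace M] [ChartedSpace E M] [IsManifold 𝓘(ℝ, E) ∞ M] [T2Space M]
  (S : VaismanStructure E M) {X Y Z : Π x : M, TangentSpace 𝓘(ℝ, E) x} {ζ : OneForm E M}

/-- The transverse 2-form `ω₀ - dζ` of the deformation defined by `ζ`. -/
noncomputable def deformForm (ζ : OneForm E M) : BilinField E M := S.omega₀ - extDeriv₁ ζ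

theorem deformForm_apply (x : M) (v w : TangentSpace 𝓘(ℝ, E) x) :
    S.deformForm ζ x v w = S.omega₀ x v w - extDeriv₁ ζ x v w := rfl

theorem extDeriv₁_θc_add (x : M) (v w : TangentSpace 𝓘(ℝ, E) x) :
    extDeriv₁ (S.θc + ζ) x v w = - S.deformForm ζ x v w := by
  rw [extDeriv₁_add, extDeriv₁_θc, deformForm_apply]
  ring

theorem deformForm_swap (x : M) (v w : TangentSpace 𝓘(ℝ, E) x) :
    S.deformForm ζ x v w = - S.deformForm ζ x w v := by
  rw [deformForm_apply, deformForm_apply, omega₀_swap, extDeriv₁_swap]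
  ring

variable {S}

theorem IsBasic.apply_U (hb : S.IsBasic ζ) (x : M) : ζ x (S.U x) = 0 := ((S.isBasic_iff ζ).1 hb x).1

theorem IsBasic.apply_V (hb : S.IsBasic ζ) (x : M) : ζ x (S.V x) = 0 := ((S.isBasic_iff ζ).1 hb x).2.1

theorem IsBasic.deformForm_U (hb : S.IsBasic ζ) (x : M) (w : TangentSpace 𝓘(ℝ, E) x) :
    S.deformForm ζ x (S.U x) w = 0 := by
  rw [deformForm_apply, omega₀_U, (((S.isBasic_iff ζ).1 hb x).2.2 w).1, sub_zero]

theorem IsBasic.deformForm_V (hb : S.IsBasic ζ) (x : M) (w : TangentSpace 𝓘(ℝ, E) x) :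
    S.deformForm ζ x (S.V x) w = 0 := by
  rw [deformForm_apply, omega₀_V, (((S.isBasic_iff ζ).1 hb x).2.2 w).2, sub_zero]

theorem IsBasic.deformForm_U_right (hb : S.IsBasic ζ) (x : M) (v : TangentSpace 𝓘(ℝ, E) x) :
    S.deformForm ζ x v (S.U x) = 0 := by
  rw [deformForm_swap, hb.deformForm_U, neg_zero]

theorem IsBasic.deformForm_V_right (hb : S.IsBasic ζ) (x : M) (v : TangentSpace 𝓘(ℝ, E) x) :
    S.deformForm ζ x v (S.V x) = 0 := by
  rw [deformForm_swap, hb.deformForm_V, neg_zero]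

variable (S) in
/-- The endomorphism field `J - ζ ⊗ U - (ζ ∘ J) ⊗ V`. -/
noncomputable def deformJ (ζ : OneForm E M) : EndField E M where
  toFun x := S.J x - (ζ x).smulRight (S.U x) - (ζ x ∘L S.J x).smulRight (S.V x)
  contMDiff_toFun := by
    refine contMDiff_clm_of_apply (V := fun x : M ↦ TangentSpace 𝓘(ℝ, E) x) _ fun X hX ↦ ?_
    exact ((hX.endField S.J).sub (SmoothField.smul (ζ.smoothFun hX) S.smoothField_U)).sub
      (SmoothField.smul (ζ.smoothFun (hX.endField S.J)) S.smoothField_V)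

variable (S) in
theorem deformJ_apply (x : M) (v : TangentSpace 𝓘(ℝ, E) x) :
    S.deformJ ζ x v = S.J x v - ζ x v • S.U x - ζ x (S.J x v) • S.V x := rfl

variable (S) in
-- Identifies `θ^c + ζ`, a primitive of `-(ω₀ - dζ)`, as the future `θ'^c`.
theorem θ_deformJ (x : M) (v : TangentSpace 𝓘(ℝ, E) x) :
    S.θ x (S.deformJ ζ x v) = - (S.θc + ζ) x v := by
  simp only [deformJ_apply, map_sub, map_smul, θ_J, θ_U, θ_V, smul_eq_mul,
    ContMDiffSection.coe_add, Pi.add_apply, add_apply]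
  ring

theorem IsBasic.θc_add_U (hb : S.IsBasic ζ) (x : M) : (S.θc + ζ) x (S.U x) = 0 := by
  simp [θc_U, hb.apply_U]

theorem IsBasic.θc_add_V (hb : S.IsBasic ζ) (x : M) : (S.θc + ζ) x (S.V x) = 1 := by
  simp [θc_V, hb.apply_V]

theorem IsBasic.θc_add_deformJ (hb : S.IsBasic ζ) (x : M) (v : TangentSpace 𝓘(ℝ, E) x) :
    (S.θc + ζ) x (S.deformJ ζ x v) = S.θ x v := by
  rw [deformJ_apply, map_sub, map_sub, map_smul, map_smul, hb.θc_add_U, hb.θc_add_V]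
  simp [θc_J]

theorem IsBasic.deformJ_deformJ (hb : S.IsBasic ζ) (x : M) (v : TangentSpace 𝓘(ℝ, E) x) :
    S.deformJ ζ x (S.deformJ ζ x v) = - v := by
  rw [deformJ_apply S x (S.deformJ ζ x v)]
  simp only [deformJ_apply S x v, map_sub, map_smul, J_J, J_U, J_V, map_neg, hb.apply_U, hb.apply_V]
  module

/-- The two endomorphisms differ by leaf directions, which lie in the kernel of `ω₀ - dζ`. -/
theorem IsBasic.deformForm_deformJ (hb : S.IsBasic ζ) (x : M) (v w : TangentSpace 𝓘(ℝ, E) x) :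
    S.deformForm ζ x (S.deformJ ζ x v) w = S.deformForm ζ x (S.J x v) w := by
  simp [deformJ_apply, hb.deformForm_U, hb.deformForm_V]

theorem IsBasic.deformForm_deformJ_right (hb : S.IsBasic ζ) (x : M)
    (v w : TangentSpace 𝓘(ℝ, E) x) :
    S.deformForm ζ x v (S.deformJ ζ x w) = S.deformForm ζ x v (S.J x w) := by
  rw [deformForm_swap, hb.deformForm_deformJ, ← deformForm_swap]

theorem deformForm_J_left (hp : S.IsPositive (S.omega₀ - extDeriv₁ ζ)) (x : M)
    (v w : TangentSpace 𝓘(ℝ, E) x) :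
    S.deformForm ζ x (S.J x v) w = - S.deformForm ζ x v (S.J x w) := by
  have h := hp.type11 x v (S.J x w)
  rw [J_J, map_neg] at h
  exact neg_eq_iff_eq_neg.1 h

variable (S) in
/-- The bilinear form `α(·, J ·) + θ ⊗ θ + β ⊗ β`, where `α = ω₀ - dζ` and `β = θ^c + ζ`. -/
noncomputable def deformInner (ζ : OneForm E M) : BilinField E M := fun x ↦
  compRight (E := E) (S.deformForm ζ x) (S.J x) + tensorSelf (E := E) (S.θ x)
    + tensorSelf (E := E) ((S.θc + ζ) x)

variable (S) in
theorem deformInner_apply (x : M) (v w : TangentSpace 𝓘(ℝ, E) x) :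
    S.deformInner ζ x v w = S.deformForm ζ x v (S.J x w) + S.θ x v * S.θ x w
      + (S.θc + ζ) x v * (S.θc + ζ) x w := rfl

/-- The term `α(v, Jv)` sees only the component of `v` in `N`, where it is positive. If that
component vanishes, `v` is a leaf vector and the two squares are the squares of its coordinates. -/
theorem deformInner_pos (hb : S.IsBasic ζ) (hp : S.IsPositive (S.omega₀ - extDeriv₁ ζ)) (x : M)
    (v : TangentSpace 𝓘(ℝ, E) x) (hv : v ≠ 0) : 0 < S.deformInner ζ x v v := by
  have hn : v - S.θ x v • S.U x - S.θc x v • S.V x ∈ S.normal x := by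
    rw [mem_normal_iff]
    simp [θ_U, θ_V, θc_U, θc_V]
  have hα : S.deformForm ζ x (v - S.θ x v • S.U x - S.θc x v • S.V x)
      (S.J x (v - S.θ x v • S.U x - S.θc x v • S.V x)) = S.deformForm ζ x v (S.J x v) := by
    simp only [map_sub, map_smul, sub_apply, smul_apply, hb.deformForm_U, hb.deformForm_V, J_U,
      J_V, map_neg, hb.deformForm_U_right, hb.deformForm_V_right, smul_zero, neg_zero, sub_zero]
  rw [deformInner_apply]
  by_cases h0 : v - S.θ x v • S.U x - S.θc x v • S.V x = 0
  · rw [h0, map_zero, zero_apply] at hα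
    rw [← hα]
    have hv' : v = S.θ x v • S.U x + S.θc x v • S.V x := by
      rw [← sub_eq_zero, ← h0]
      module
    have hβ : (S.θc + ζ) x v = S.θc x v := by
      rw [hv']
      simp only [map_add, map_smul, hb.θc_add_U, hb.θc_add_V, θc_U, θc_V]
    rw [hβ]
    by_contra hle
    have h1 : S.θ x v = 0 := by nlinarith [mul_self_nonneg (S.θ x v), mul_self_nonneg (S.θc x v)]
    have h2 : S.θc x v = 0 := by nlinarith [mul_self_nonneg (S.θ x v), mul_self_nonneg (S.θc x v)]
    rw [h1, h2, zero_smul, zero_smul, add_zero] at hv'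
    exact hv hv'
  · have := hp.pos x _ hn h0
    rw [← deformForm, hα] at this
    nlinarith [mul_self_nonneg (S.θ x v), mul_self_nonneg ((S.θc + ζ) x v)]

/-- The Riemannian metric of the deformation defined by `ζ`. -/
noncomputable def deformMetric (hb : S.IsBasic ζ) (hp : S.IsPositive (S.omega₀ - extDeriv₁ ζ)) :
    Metric E M where
  inner := S.deformInner ζ
  symm x v w := by
    rw [deformInner_apply, deformInner_apply, deformForm_swap, deformForm_J_left hp]
    ring
  pos := deformInner_pos hb hp
  isVonNBounded x := isVonNBounded_of_pos (E := E) (S.deformInner ζ x) (deformInner_pos hb hp x)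
  contMDiff := by
    refine contMDiff_bilin_of_apply _ fun X Y hX hY ↦ ?_
    -- By type `(1,1)`, `α(X, JY) = -α(JX, Y) = dβ(JX, Y)`, which is smooth.
    have h := smoothFun_extDeriv₁ (S.θc + ζ) (hX.endField S.J) hY
    simp only [extDeriv₁_θc_add, deformForm_J_left hp, neg_neg] at h
    exact (h.fun_add ((S.θ.smoothFun hX).fun_mul (S.θ.smoothFun hY))).fun_add
      (((S.θc + ζ).smoothFun hX).fun_mul ((S.θc + ζ).smoothFun hY))

theorem deformMetric_apply (hb : S.IsBasic ζ) (hp : S.IsPositive (S.omega₀ - extDeriv₁ ζ)) (x : M)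
    (v w : TangentSpace 𝓘(ℝ, E) x) : (deformMetric hb hp).inner x v w =
      S.deformForm ζ x v (S.J x w) + S.θ x v * S.θ x w + (S.θc + ζ) x v * (S.θc + ζ) x w := rfl

theorem deformMetric_U (hb : S.IsBasic ζ) (hp : S.IsPositive (S.omega₀ - extDeriv₁ ζ)) (x : M)
    (w : TangentSpace 𝓘(ℝ, E) x) : (deformMetric hb hp).inner x (S.U x) w = S.θ x w := by
  rw [deformMetric_apply, hb.deformForm_U, hb.θc_add_U, θ_U]
  ring

theorem sharp_deformMetric (hb : S.IsBasic ζ) (hp : S.IsPositive (S.omega₀ - extDeriv₁ ζ)) :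
    sharp (deformMetric hb hp) S.θ = S.U := by
  funext x
  refine (metric_bijective (deformMetric hb hp) x).1 (ContinuousLinearMap.ext fun w ↦ ?_)
  rw [inner_sharp, deformMetric_U]

/-- The Nijenhuis tensor is tangent to the leaves and annihilated by `θ` and `θ^c + ζ`, which are
coordinates on each leaf. -/
theorem isComplexStructure_deformJ (hb : S.IsBasic ζ)
    (hp : S.IsPositive (S.omega₀ - extDeriv₁ ζ)) : IsComplexStructure (S.deformJ ζ) where
  sq := hb.deformJ_deformJ
  nijenhuis X Y hX hY x := by
    have hleaf := S.nijenhuis_mem_leaf (J' := S.deformJ ζ) (a := -ζ) (b := act S.J ζ)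
      (fun x v ↦ by
        change _ = S.J x v + (- ζ x v) • S.U x + (- ζ x (S.J x v)) • S.V x
        rw [deformJ_apply]
        module) hX hY x
    obtain ⟨h1, h2⟩ := apply_nijenhuis_eq_zero S.closed S.θ_deformJ hb.θc_add_deformJ
      hb.deformJ_deformJ (fun x v w ↦ by
        rw [extDeriv₁_θc_add, extDeriv₁_θc_add, hb.deformForm_deformJ,
          hb.deformForm_deformJ_right]
        exact congrArg Neg.neg (hp.type11 x v w)) hX hY x
    have h3 := eq_smul_of_mem_leaf hleaf
    rw [h1, zero_smul, zero_add] at h3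
    rw [h3, map_smul, hb.θc_add_V, smul_eq_mul, mul_one] at h2
    rw [h3, h2, zero_smul]

/-- All the ingredients of the metric are invariant under `U`: the forms `θ` and `θ^c + ζ` are
constant on `U` with `ι_U d = 0`, `α` is closed with `ι_U α = 0`, and `U` is `J`-holomorphic. -/
theorem isKilling_deformMetric (hb : S.IsBasic ζ) (hp : S.IsPositive (S.omega₀ - extDeriv₁ ζ)) :
    IsKilling (deformMetric hb hp) S.U := by
  intro X Y hX hY x
  have hα : ∀ (x : M) (v : TangentSpace 𝓘(ℝ, E) x), extDeriv₁ (S.θc + ζ) x (S.U x) v = 0 :=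
    fun x v ↦ by rw [extDeriv₁_θc_add, hb.deformForm_U, neg_zero]
  have inv : ∀ {Z : Π x : M, TangentSpace 𝓘(ℝ, E) x}, SmoothField Z →
      dirDeriv S.U (fun y ↦ S.θ y (Z y)) x = S.θ x (mlieBracket 𝓘(ℝ, E) S.U Z x) ∧
      dirDeriv S.U (fun y ↦ (S.θc + ζ) y (Z y)) x =
        (S.θc + ζ) x (mlieBracket 𝓘(ℝ, E) S.U Z x) := by
    intro Z hZ
    have h1 := extDeriv₁_fields S.θ S.smoothField_U hZ x
    have h2 := extDeriv₁_fields (S.θc + ζ) S.smoothField_U hZ x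
    have h0 : extDeriv₁ S.θ x (S.U x) (Z x) = 0 := by rw [S.closed]; rfl
    simp only [hα, h0, θ_U, hb.θc_add_U, dirDeriv_const] at h1 h2
    constructor <;> linarith
  have h := dirDeriv_extDeriv₁ S.smoothField_U hα hX (hY.endField S.J) x
  rw [S.mlieBracket_U_J hY] at h
  simp only [extDeriv₁_θc_add, dirDeriv_neg] at h
  have hs := smoothFun_extDeriv₁ (S.θc + ζ) (hX.endField S.J) hY
  simp only [extDeriv₁_θc_add, deformForm_J_left hp, neg_neg] at hs
  simp only [deformMetric_apply]
  rw [dirDeriv_add (hs.fun_add ((S.θ.smoothFun hX).fun_mul (S.θ.smoothFun hY)))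
      (((S.θc + ζ).smoothFun hX).fun_mul ((S.θc + ζ).smoothFun hY)),
    dirDeriv_add hs ((S.θ.smoothFun hX).fun_mul (S.θ.smoothFun hY)),
    dirDeriv_mul (S.θ.smoothFun hX) (S.θ.smoothFun hY),
    dirDeriv_mul ((S.θc + ζ).smoothFun hX) ((S.θc + ζ).smoothFun hY),
    (inv hX).1, (inv hX).2, (inv hY).1, (inv hY).2]
  linarith

/-- The Vaisman structure defined by a basic 1-form `ζ` such that `ω₀ - dζ` is positive. -/
noncomputable def deform (hb : S.IsBasic ζ) (hp : S.IsPositive (S.omega₀ - extDeriv₁ ζ)) :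
    VaismanStructure E M where
  J := S.deformJ ζ
  g := deformMetric hb hp
  θ := S.θ
  complex := isComplexStructure_deformJ hb hp
  hermitian x v w := by
    rw [deformMetric_apply, deformMetric_apply, hb.deformForm_deformJ, deformForm_J_left hp,
      θ_deformJ, θ_deformJ, hb.θc_add_deformJ, hb.θc_add_deformJ]
    have h : S.J x (S.J x (S.deformJ ζ x w)) = - S.deformJ ζ x w := S.J_J x _
    rw [h, map_neg, hb.deformForm_deformJ_right]
    ring
  closed := S.closed
  lck X Y Z hX hY hZ x := by
    -- The new fundamental form is `θ ∧ β - dβ`.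
    refine extDeriv₂_wedge_sub (β := S.θc + ζ) S.closed (fun x v w ↦ ?_) hX hY hZ x
    change (deformMetric hb hp).inner x (S.deformJ ζ x v) w = _
    rw [deformMetric_apply, hb.deformForm_deformJ, deformForm_J_left hp, J_J, map_neg, θ_deformJ,
      hb.θc_add_deformJ, extDeriv₁_θc_add]
    ring
  parallel := by
    -- The old connection serves only as a torsion-free starting point for the Levi-Civita
    -- connection of the new metric.
    obtain ⟨D, hD, -⟩ := S.parallel
    obtain ⟨D', hD'⟩ := hD.exists_of_isLeviCivita (deformMetric hb hp)
    refine ⟨D', hD', IsKilling.isParallel hD' S.closed ?_⟩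
    rw [sharp_deformMetric]
    exact isKilling_deformMetric hb hp
  unit x := by rw [sharp_deformMetric, deformMetric_U, θ_U]
  not_exact := S.not_exact

theorem deform_U (hb : S.IsBasic ζ) (hp : S.IsPositive (S.omega₀ - extDeriv₁ ζ)) :
    (deform hb hp).U = S.U :=
  sharp_deformMetric hb hp

theorem deform_V (hb : S.IsBasic ζ) (hp : S.IsPositive (S.omega₀ - extDeriv₁ ζ)) :
    (deform hb hp).V = S.V := by
  funext x
  change S.deformJ ζ x ((deform hb hp).U x) = _
  rw [deform_U, deformJ_apply, J_U, hb.apply_U, hb.apply_V]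
  simp

theorem deform_θc (hb : S.IsBasic ζ) (hp : S.IsPositive (S.omega₀ - extDeriv₁ ζ)) :
    (deform hb hp).θc = S.θc + ζ := by
  ext x v
  change - S.θ x (S.deformJ ζ x v) = _
  rw [θ_deformJ, neg_neg]

theorem deform_mem_deformations (hb : S.IsBasic ζ)
    (hp : S.IsPositive (S.omega₀ - extDeriv₁ ζ)) : deform hb hp ∈ S.deformations := by
  refine ⟨rfl, deform_U hb hp, deform_V hb hp, fun x v ↦ ?_⟩
  rw [Submodule.mkQ_apply, Submodule.mkQ_apply, Submodule.Quotient.eq]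
  change S.deformJ ζ x v - S.J x v ∈ S.leaf x
  convert neg_mem (add_mem (Submodule.smul_mem _ (ζ x v) (S.U_mem_leaf x))
    (Submodule.smul_mem _ (ζ x (S.J x v)) (S.V_mem_leaf x))) using 1
  rw [deformJ_apply]
  module

end VaismanStructure

/-! ### Recovering `ζ` from a deformation -/

namespace VaismanStructure

variable {E : Type*} [NormedAddCommGroup E] [NormedSpace ℝ E] [FiniteDimensional ℝ E]
  {M : Type*} [TopologicalSpace M] [ChartedSpace E M] [IsManifold 𝓘(ℝ, E) ∞ M] [T2Space M]
  {S S' : VaismanStructure E M}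

theorem J_sub_mem_leaf (h : S' ∈ S.deformations) (x : M) (v : TangentSpace 𝓘(ℝ, E) x) :
    S'.J x v - S.J x v ∈ S.leaf x := by
  have := h.2.2.2 x v
  rwa [Submodule.mkQ_apply, Submodule.mkQ_apply, Submodule.Quotient.eq] at this

theorem θc_U_of_mem (h : S' ∈ S.deformations) (x : M) : S'.θc x (S.U x) = 0 := by
  rw [← h.2.1, θc_U]

theorem θc_V_of_mem (h : S' ∈ S.deformations) (x : M) : S'.θc x (S.V x) = 1 := by
  rw [← h.2.2.1, θc_V]

/-- The leaf vector `J'v - Jv` has `U`-coordinate `θ(J'v - Jv) = -ζ(v)`. Its `V`-coordinate may be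
read off with `θ'^c`, which agrees with `θ^c` on leaves: `θ'^c(J'v) - θ'^c(Jv) = θ(v) - (θ(v) +
ζ(Jv))`. -/
theorem J_eq_of_mem (h : S' ∈ S.deformations) (x : M) (v : TangentSpace 𝓘(ℝ, E) x) :
    S'.J x v = S.J x v - (S'.θc - S.θc) x v • S.U x - (S'.θc - S.θc) x (S.J x v) • S.V x := by
  have h1 := eq_smul_of_mem_leaf (J_sub_mem_leaf h x v)
  have h2 : S'.J x v - S.J x v = S.θ x (S'.J x v - S.J x v) • S.U x
      + S'.θc x (S'.J x v - S.J x v) • S.V x := by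
    have h3 : S'.θc x (S'.J x v - S.J x v) = S.θc x (S'.J x v - S.J x v) := by
      rw [h1]
      simp [θc_U_of_mem h, θc_V_of_mem h, θc_U, θc_V]
    rw [h3]
    exact h1
  have h4 : S.θ x (S'.J x v) = - S'.θc x v := by rw [← h.1, θ_J]
  rw [map_sub, map_sub, h4, θ_J, θc_J, h.1] at h2
  rw [← sub_add_cancel (S'.J x v) (S.J x v), h2]
  simp only [ContMDiffSection.coe_sub, Pi.sub_apply, sub_apply, θc_J]
  module

theorem omega₀_leaf_of_mem (h : S' ∈ S.deformations) {x : M} {u : TangentSpace 𝓘(ℝ, E) x}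
    (hu : u ∈ S.leaf x) (v : TangentSpace 𝓘(ℝ, E) x) : S'.omega₀ x u v = 0 := by
  have hU := S'.omega₀_U x v
  have hV := S'.omega₀_V x v
  rw [h.2.1] at hU
  rw [h.2.2.1] at hV
  rw [eq_smul_of_mem_leaf hu, map_add, map_smul, map_smul, add_apply, smul_apply, smul_apply, hU,
    hV, smul_zero, smul_zero, add_zero]

theorem omega₀_J_left_of_mem (h : S' ∈ S.deformations) (x : M) (v w : TangentSpace 𝓘(ℝ, E) x) :
    S'.omega₀ x (S'.J x v) w = S'.omega₀ x (S.J x v) w := by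
  have := omega₀_leaf_of_mem h (J_sub_mem_leaf h x v) w
  rwa [map_sub, sub_apply, sub_eq_zero] at this

theorem omega₀_J_right_of_mem (h : S' ∈ S.deformations) (x : M) (v w : TangentSpace 𝓘(ℝ, E) x) :
    S'.omega₀ x v (S'.J x w) = S'.omega₀ x v (S.J x w) := by
  rw [omega₀_swap, omega₀_J_left_of_mem h, ← omega₀_swap]

theorem deformForm_of_mem (x : M) (v w : TangentSpace 𝓘(ℝ, E) x) :
    S.deformForm (S'.θc - S.θc) x v w = S'.omega₀ x v w := by
  rw [deformForm_apply, extDeriv₁_sub, extDeriv₁_θc, extDeriv₁_θc]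
  ring

theorem isBasic_of_mem (h : S' ∈ S.deformations) : S.IsBasic (S'.θc - S.θc) := by
  refine (S.isBasic_iff _).2 fun x ↦ ⟨?_, ?_, fun v ↦ ⟨?_, ?_⟩⟩
  · simp [θc_U_of_mem h, θc_U]
  · simp [θc_V_of_mem h, θc_V]
  · rw [extDeriv₁_sub, extDeriv₁_θc, extDeriv₁_θc, omega₀_U, omega₀_leaf_of_mem h (S.U_mem_leaf x),
      sub_self]
  · rw [extDeriv₁_sub, extDeriv₁_θc, extDeriv₁_θc, omega₀_V, omega₀_leaf_of_mem h (S.V_mem_leaf x),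
      sub_self]

/-- A rearrangement of `ω = θ ∧ θ^c + ω₀`. It shows that `J` and `θ` determine the metric, so `ζ`
carries all the data of a deformation. -/
theorem inner_eq (S : VaismanStructure E M) (x : M) (v w : TangentSpace 𝓘(ℝ, E) x) :
    S.g.inner x v w = S.omega₀ x v (S.J x w) + S.θ x v * S.θ x w + S.θc x v * S.θc x w := by
  rw [omega₀_apply, S.hermitian, θ_J, θc_J]
  ring

theorem isPositive_of_mem (h : S' ∈ S.deformations) :
    S.IsPositive (S.omega₀ - extDeriv₁ (S'.θc - S.θc)) where
  type11 x v w := by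
    change S.deformForm _ _ _ _ = S.deformForm _ _ _ _
    rw [deformForm_of_mem, deformForm_of_mem, ← omega₀_J_left_of_mem h, ← omega₀_J_right_of_mem h,
      omega₀_J_J]
  pos x v hv hv0 := by
    change 0 < S.deformForm _ _ _ _
    rw [deformForm_of_mem, ← omega₀_J_right_of_mem h]
    obtain ⟨h1, h2⟩ := S.mem_normal_iff.1 hv
    -- The normal bundles of `g` and `g'` may differ. Subtracting `θ'^c(v) V` moves `v` into the
    -- normal bundle of `g'` (no `U`-term is needed as `θ(v) = 0`), and `ω₀'` does not see the
    -- change.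
    have hu : S'.θc x v • S.V x ∈ S.leaf x := Submodule.smul_mem _ _ (S.V_mem_leaf x)
    have hw0 : v - S'.θc x v • S.V x ≠ 0 := by
      intro h0
      rw [sub_eq_zero] at h0
      have h3 := congrArg (S.θc x) h0
      rw [map_smul, h2, θc_V, smul_eq_mul, mul_one] at h3
      rw [← h3, zero_smul] at h0
      exact hv0 h0
    have hpos := S'.g.pos x _ hw0
    have hθ : S'.θ x (v - S'.θc x v • S.V x) = 0 := by
      rw [h.1, map_sub, map_smul, h1, θ_V, smul_zero, sub_zero]
    have hθc : S'.θc x (v - S'.θc x v • S.V x) = 0 := by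
      rw [map_sub, map_smul, θc_V_of_mem h, smul_eq_mul, mul_one, sub_self]
    have hJu : S'.omega₀ x v (S.J x (S'.θc x v • S.V x)) = 0 := by
      rw [omega₀_swap, omega₀_leaf_of_mem h (S.J_mem_leaf hu), neg_zero]
    rw [inner_eq, hθ, hθc, map_sub, sub_apply, omega₀_leaf_of_mem h hu, omega₀_J_right_of_mem h,
      map_sub (S.J x), map_sub, hJu, ← omega₀_J_right_of_mem h] at hpos
    linarith

/-- `J_eq_of_mem` matches the complex structures. The metrics then agree because `inner_eq` for `S'`
is the defining formula of the deformed metric. -/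
theorem deform_of_mem (h : S' ∈ S.deformations) :
    deform (isBasic_of_mem h) (isPositive_of_mem h) = S' := by
  refine VaismanStructure.ext ?_ ?_ h.1.symm
  · ext x v
    rw [J_eq_of_mem h]
    rfl
  · refine Metric.ext_inner fun x v w ↦ ?_
    change (deformMetric (isBasic_of_mem h) (isPositive_of_mem h)).inner x v w = _
    rw [deformMetric_apply, deformForm_of_mem, ← omega₀_J_right_of_mem h, inner_eq, h.1,
      add_sub_cancel]

/-- The bijection between the positive basic 1-forms and the deformations of `S`. -/
noncomputable def deformEquiv (S : VaismanStructure E M) : S.positiveForms ≃ S.deformations where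
  toFun ζ := ⟨deform ζ.2.1 ζ.2.2, deform_mem_deformations ζ.2.1 ζ.2.2⟩
  invFun S' := ⟨S'.1.θc - S.θc, isBasic_of_mem S'.2, isPositive_of_mem S'.2⟩
  left_inv ζ := Subtype.ext ((congrArg (· - S.θc) (deform_θc ζ.2.1 ζ.2.2)).trans
    (add_sub_cancel_left _ _))
  right_inv S' := Subtype.ext (deform_of_mem S'.2)

end VaismanStructure

end Vaisman

theorem proposition4p1 {E : Type*} [NormedAddCommGroup E] [NormedSpace ℝ E] [FiniteDimensional ℝ E]
    (n : ℕ) (hn : 2 ≤ n) (hE : Module.finrank ℝ E = 2 * n)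
    {M : Type*} [TopologicalSpace M] [ChartedSpace E M] [IsManifold 𝓘(ℝ, E) ∞ M]
    [T2Space M] [CompactSpace M] [ConnectedSpace M]
    (S : Vaisman.VaismanStructure E M) :
    ∃ Φ : S.positiveForms ≃ S.deformations,
      (∀ (ζ : S.positiveForms) (x : M) (v : TangentSpace 𝓘(ℝ, E) x),
        (Φ ζ).1.J x v = S.J x v - ζ.1 x v • S.U x - ζ.1 x (S.J x v) • S.V x) ∧
      ∀ S' : S.deformations, (Φ.symm S').1 = S'.1.θc - S.θc :=
  ⟨S.deformEquiv, fun _ _ _ ↦ rfl, fun _ ↦ rfl⟩
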